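/- Let INF (intuitionistic NF) be the theory in intuitionistic first-order logic with equality whose only non-logical symbol is the binary predicate $\in$ and whose axioms are extensionality, $\forall x\forall y\,(\forall z\,(z\in x\leftrightarrow z\in y)\to x=y)$, and stratified comprehension: $\exists y\,\forall x\,(x\in y\leftrightarrow\varphi)$ for every stratified formula $\varphi$ (parameters allowed, $y$ not free in $\varphi$). A formula is stratified if its variables can be assigned non-negative integers so that $y$ gets one more than $x$ in each subformula $x\in y$, and $x,y$ get the same integer in each subformula $x=y$. In INF use the following definitions. * $\Lambda$ is the empty set; $\langle x,y\rangle=\{\{x\},\{x,y\}\}$; $\langle x,y,z\rangle=\langle\langle x,y\rangle,\{\{z\}\}\rangle$; $X\times Y$ is the set of all $\langle x,y\rangle$ with $x\in X$, $y\in Y$; $USC(x)=\{\{a\}: a\in x\}$. * $X$ is finite if it belongs to every $W$ such that $\Lambda\in W$ and, whenever $u\in W$ and $z\notin u$, also $u\cup\{z\}\in W$. * $A$ has decidable equality if $\forall x,y\in A\,(x=y\lor x\neq y)$. * $f:X\to Y$ means that for every $x\in X$ there is a unique $y\in Y$ with $\langle x,y\rangle\in f$; such an $f$ is one-to-one if $y\in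 Y$ and $\langle x,y\rangle\in f$ imply $x\in X$, and $f(x)=f(z)$ implies $x=z$ for $x,z\in X$; $X\sim Y$ means that some $f:X\to Y$ is one-to-one and onto. * $Nc(x)=\{u:u\sim x\}$; $\mathbb T(\kappa)=\{u:\exists x\,(x\in\kappa\land u\sim USC(x))\}$; $\mathbb T^2(\kappa)=\mathbb T(\mathbb T(\kappa))$. * $\mathsf{zero}=\{\Lambda\}$; $\kappa^+=\{x:\exists z,a\,(z\in\kappa\land a\notin z\land x=z\cup\{a\})\}$; $x+y=\{z:\exists u,v\,(u\in x\land v\in y\land u\cap v=\Lambda\land z=u\cup v)\}$. * $SF$ is the intersection of all sets that contain $\mathsf{zero}$ and are closed under $\kappa\mapsto\kappa^+$. $\mathbb G$ is the intersection of all $w$ such that $\langle x,\mathsf{zero},\mathsf{zero}\rangle\in w$ and $\langle\mathsf{zero},x,\mathsf{zero}\rangle\in w$ for all $x\in SF$, and such that $\langle x,y,z\rangle\in w$ implies $\langle x,y^+,z+x\rangle\in w$. Finally $x\cdot y=\{u:\exists z\,(\langle x,y,z\rangle\in\mathbb G\land u\in z)\}$. **Lemma.** INF proves: if $A$ is a set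 with decidable equality and $X$, $Y$ are finite subsets of $A$, then $X\times Y$ is finite, and, with $\kappa=Nc(X)$ and $\mu=Nc(Y)$, $$\mathbb T^2(\kappa)\cdot\mathbb T^2(\mu)=Nc(X\times Y).$$ -/

import Mathlib

namespace INF

/-- First-order formulas over `∈` and `=`. Variables are de Bruijn indices: under a quantifier,
index `0` is the variable just bound and an outer variable `x` is written `x + 1`; an index that
points beyond all quantifiers is a free variable. -/
inductive Fml : Type
  | bot : Fml
  | mem : ℕ → ℕ → Fml
  | eq : ℕ → ℕ → Fml
  | and : Fml → Fml → Fml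
  | or : Fml → Fml → Fml
  | imp : Fml → Fml → Fml
  | all : Fml → Fml
  | ex : Fml → Fml

/-- Extension of a renaming to the scope of a quantifier. -/
def up (f : ℕ → ℕ) : ℕ → ℕ
  | 0 => 0
  | n + 1 => f n + 1

/-- Capture-avoiding renaming of the free variables. -/
def Fml.rename : (ℕ → ℕ) → Fml → Fml
  | _, .bot => .bot
  | f, .mem x y => .mem (f x) (f y)
  | f, .eq x y => .eq (f x) (f y)
  | f, .and φ ψ => .and (φ.rename f) (ψ.rename f)
  | f, .or φ ψ => .or (φ.rename f) (ψ.rename f)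
  | f, .imp φ ψ => .imp (φ.rename f) (ψ.rename f)
  | f, .all φ => .all (φ.rename (up f))
  | f, .ex φ => .ex (φ.rename (up f))

/-- `φ` placed under one further quantifier whose variable does not occur in it. -/
def Fml.shift (φ : Fml) : Fml := φ.rename (· + 1)

/-- The renaming `0 ↦ t`, `n + 1 ↦ n`. -/
def point (t : ℕ) : ℕ → ℕ
  | 0 => t
  | n + 1 => n

/-- The instance `φ[t]` of the body `φ` of a quantifier (variables are the only terms). -/
def Fml.inst (φ : Fml) (t : ℕ) : Fml := φ.rename (point t)

infix:50 " ∈ₛ " => Fml.mem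
infix:50 " ≐ " => Fml.eq
infixr:35 " ⋏ " => Fml.and
infixr:30 " ⋎ " => Fml.or
infixr:25 " ⇒ₛ " => Fml.imp
notation "∀ₛ " φ:10 => Fml.all φ
notation "∃ₛ " φ:10 => Fml.ex φ

def Fml.neg (φ : Fml) : Fml := φ ⇒ₛ Fml.bot

def Fml.iff (φ ψ : Fml) : Fml := (φ ⇒ₛ ψ) ⋏ (ψ ⇒ₛ φ)

infix:20 " ⇔ₛ " => Fml.iff

/-- Extension of an assignment of indices by the index `k` for a newly bound variable. -/
def cons (k : ℕ) (τ : ℕ → ℕ) : ℕ → ℕ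
  | 0 => k
  | n + 1 => τ n

/-- `StratBy τ φ`: if the free variables get the indices `τ`, the bound variables can be given
indices so that `y` gets one more than `x` in each `x ∈ y`, and `x`, `y` get the same index in
each `x = y`. -/
def StratBy : (ℕ → ℕ) → Fml → Prop
  | _, .bot => True
  | τ, .mem x y => τ y = τ x + 1
  | τ, .eq x y => τ x = τ y
  | τ, .and φ ψ => StratBy τ φ ∧ StratBy τ ψ
  | τ, .or φ ψ => StratBy τ φ ∧ StratBy τ ψ
  | τ, .imp φ ψ => StratBy τ φ ∧ StratBy τ ψ
  | τ, .all φ => ∃ k, StratBy (cons k τ) φ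
  | τ, .ex φ => ∃ k, StratBy (cons k τ) φ

def Stratified (φ : Fml) : Prop := ∃ τ, StratBy τ φ

/-- `z = {x : φ}`. In `φ`, the variable `x` is `0`, and every other variable is shifted by one. -/
def isSetOf (z : ℕ) (φ : Fml) : Fml := ∀ₛ (0 ∈ₛ (z + 1) ⇔ₛ φ)

/-- The axioms: extensionality, and `∃ y, ∀ x, (x ∈ y ↔ φ)` for each stratified `φ`. In the
second, `x` is variable `0` of `φ`, the other free variables of `φ` are parameters, and the
renaming makes room for `y`, which does not occur in `φ`. -/
inductive IsAxiom : Fml → Prop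
  | extensionality :
      IsAxiom (∀ₛ ∀ₛ ((∀ₛ (0 ∈ₛ 2 ⇔ₛ 0 ∈ₛ 1)) ⇒ₛ 1 ≐ 0))
  | comprehension (φ : Fml) : Stratified φ →
      IsAxiom (∃ₛ isSetOf 0 (φ.rename (up (· + 1))))

/-- Natural deduction for intuitionistic first-order logic with equality, from the axioms. -/
inductive Derives : List Fml → Fml → Prop
  | ax {Γ φ} : IsAxiom φ → Derives Γ φ
  | hyp {Γ φ} : φ ∈ Γ → Derives Γ φ
  | botE {Γ φ} : Derives Γ Fml.bot → Derives Γ φ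
  | andI {Γ φ ψ} : Derives Γ φ → Derives Γ ψ → Derives Γ (φ ⋏ ψ)
  | andE₁ {Γ φ ψ} : Derives Γ (φ ⋏ ψ) → Derives Γ φ
  | andE₂ {Γ φ ψ} : Derives Γ (φ ⋏ ψ) → Derives Γ ψ
  | orI₁ {Γ φ ψ} : Derives Γ φ → Derives Γ (φ ⋎ ψ)
  | orI₂ {Γ φ ψ} : Derives Γ ψ → Derives Γ (φ ⋎ ψ)
  | orE {Γ φ ψ χ} : Derives Γ (φ ⋎ ψ) → Derives (φ :: Γ) χ → Derives (ψ :: Γ) χ → Derives Γ χ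
  | impI {Γ φ ψ} : Derives (φ :: Γ) ψ → Derives Γ (φ ⇒ₛ ψ)
  | impE {Γ φ ψ} : Derives Γ (φ ⇒ₛ ψ) → Derives Γ φ → Derives Γ ψ
  | allI {Γ φ} : Derives (Γ.map Fml.shift) φ → Derives Γ (∀ₛ φ)
  | allE {Γ φ} (t : ℕ) : Derives Γ (∀ₛ φ) → Derives Γ (φ.inst t)
  | exI {Γ φ} (t : ℕ) : Derives Γ (φ.inst t) → Derives Γ (∃ₛ φ)
  | exE {Γ φ ψ} : Derives Γ (∃ₛ φ) → Derives (φ :: Γ.map Fml.shift) ψ.shift → Derives Γ ψ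
  | eqI {Γ} (t : ℕ) : Derives Γ (t ≐ t)
  | eqE {Γ} (φ : Fml) {s t : ℕ} : Derives Γ (s ≐ t) → Derives Γ (φ.inst s) → Derives Γ (φ.inst t)

/-- Provability in intuitionistic NF. -/
def Provable (φ : Fml) : Prop := Derives [] φ

/-! ### Set-theoretic notions, as formulas about the variables `x`, `y`, … given as arguments.
Defined terms are eliminated in the usual way: `Φ(t)` is `∃ v, v = t ∧ Φ(v)`. -/

/-- `x ⊆ y` -/
def isSubset (x y : ℕ) : Fml := ∀ₛ (0 ∈ₛ (x + 1) ⇒ₛ 0 ∈ₛ (y + 1))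

/-- `z = Λ`, the empty set -/
def isEmpty (z : ℕ) : Fml := isSetOf z Fml.bot

/-- `z = {x}` -/
def isSingle (z x : ℕ) : Fml := isSetOf z (0 ≐ (x + 1))

/-- `z = {x, y}` -/
def isUPair (z x y : ℕ) : Fml := isSetOf z (0 ≐ (x + 1) ⋎ 0 ≐ (y + 1))

/-- `z = ⟨x, y⟩ = {{x}, {x, y}}` -/
def isPair (z x y : ℕ) : Fml :=
  isSetOf z (isSingle 0 (x + 1) ⋎ isUPair 0 (x + 1) (y + 1))

/-- `⟨x, y⟩ ∈ f` -/
def pairMem (x y f : ℕ) : Fml := ∃ₛ (isPair 0 (x + 1) (y + 1) ⋏ 0 ∈ₛ (f + 1))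

/-- `t = ⟨x, y, z⟩ = ⟨⟨x, y⟩, {{z}}⟩`; the bound variables are `p = ⟨x, y⟩` (index `2`),
`a = {z}` (index `1`), `b = {a}` (index `0`). -/
def isTriple (t x y z : ℕ) : Fml :=
  ∃ₛ ∃ₛ ∃ₛ (isPair 2 (x + 3) (y + 3) ⋏ isSingle 1 (z + 3) ⋏ isSingle 0 1 ⋏ isPair (t + 3) 2 0)

/-- `⟨x, y, z⟩ ∈ w` -/
def tripleMem (x y z w : ℕ) : Fml :=
  ∃ₛ (isTriple 0 (x + 1) (y + 1) (z + 1) ⋏ 0 ∈ₛ (w + 1))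

/-- `z = u ∪ v` -/
def isUnion (z u v : ℕ) : Fml := isSetOf z (0 ∈ₛ (u + 1) ⋎ 0 ∈ₛ (v + 1))

/-- `u ∩ v = Λ` -/
def disjoint (u v : ℕ) : Fml := ∀ₛ (0 ∈ₛ (u + 1) ⋏ 0 ∈ₛ (v + 1)).neg

/-- `w = u ∪ {a}` -/
def isAdjoin (w u a : ℕ) : Fml := isSetOf w (0 ∈ₛ (u + 1) ⋎ 0 ≐ (a + 1))

/-- `x ∈ FINITE`: `x` belongs to every `W` such that `Λ ∈ W`, and `u ∪ {z} ∈ W` whenever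
`u ∈ W` and `z ∉ u`. -/
def isFinite (x : ℕ) : Fml :=
  ∀ₛ ((∃ₛ (isEmpty 0 ⋏ 0 ∈ₛ 1)) ⋏
      (∀ₛ ∀ₛ (1 ∈ₛ 2 ⋏ (0 ∈ₛ 1).neg ⇒ₛ ∃ₛ (isAdjoin 0 2 1 ⋏ 0 ∈ₛ 3)))
    ⇒ₛ (x + 1) ∈ₛ 0)

/-- `X` has decidable equality: `∀ x, y ∈ X (x = y ∨ x ≠ y)`. -/
def hasDecEq (X : ℕ) : Fml :=
  ∀ₛ ∀ₛ (1 ∈ₛ (X + 2) ⋏ 0 ∈ₛ (X + 2) ⇒ₛ 1 ≐ 0 ⋎ (1 ≐ 0).neg)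

/-- `f : X → Y`: for each `x ∈ X` there is a unique `y ∈ Y` with `⟨x, y⟩ ∈ f`. -/
def maps (f X Y : ℕ) : Fml :=
  ∀ₛ (0 ∈ₛ (X + 1) ⇒ₛ
    ∃ₛ (0 ∈ₛ (Y + 2) ⋏ pairMem 1 0 (f + 2) ⋏
      ∀ₛ (0 ∈ₛ (Y + 3) ⋏ pairMem 2 0 (f + 3) ⇒ₛ 0 ≐ 1)))

/-- For `f : X → Y`, `f` is one-to-one: `y ∈ Y` and `⟨x, y⟩ ∈ f` imply `x ∈ X`, and
`f(x) = f(z)` implies `x = z` for `x, z ∈ X`. In the second clause `x`, `z` and the common value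
`y ∈ Y` are the variables `2`, `1`, `0`. -/
def oneToOne (f X Y : ℕ) : Fml :=
  (∀ₛ ∀ₛ (0 ∈ₛ (Y + 2) ⋏ pairMem 1 0 (f + 2) ⇒ₛ 1 ∈ₛ (X + 2))) ⋏
  (∀ₛ ∀ₛ ∀ₛ (2 ∈ₛ (X + 3) ⋏ 1 ∈ₛ (X + 3) ⋏ 0 ∈ₛ (Y + 3) ⋏
      pairMem 2 0 (f + 3) ⋏ pairMem 1 0 (f + 3) ⇒ₛ 2 ≐ 1))

/-- `f` is onto `Y`. -/
def onto (f X Y : ℕ) : Fml :=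
  ∀ₛ (0 ∈ₛ (Y + 1) ⇒ₛ ∃ₛ (0 ∈ₛ (X + 2) ⋏ pairMem 0 1 (f + 2)))

/-- `X ∼ Y`: some `f : X → Y` is one-to-one and onto. -/
def similar (X Y : ℕ) : Fml :=
  ∃ₛ (maps 0 (X + 1) (Y + 1) ⋏ oneToOne 0 (X + 1) (Y + 1) ⋏ onto 0 (X + 1) (Y + 1))

/-- `κ = Nc(x) = {u : u ∼ x}` -/
def isNc (κ x : ℕ) : Fml := isSetOf κ (similar 0 (x + 1))

/-- `s = USC(x)`, the set of all `{a}` with `a ∈ x` -/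
def isUSC (s x : ℕ) : Fml := isSetOf s (∃ₛ (0 ∈ₛ (x + 2) ⋏ isSingle 1 0))

/-- `σ = 𝕋(κ) = {u : ∃ x, x ∈ κ ∧ u ∼ USC(x)}` -/
def isT (σ κ : ℕ) : Fml :=
  isSetOf σ (∃ₛ (0 ∈ₛ (κ + 2) ⋏ ∃ₛ (isUSC 0 1 ⋏ similar 2 0)))

/-- `σ = 𝕋²(κ) = 𝕋(𝕋(κ))` -/
def isT2 (σ κ : ℕ) : Fml := ∃ₛ (isT 0 (κ + 1) ⋏ isT (σ + 1) 0)

/-- `o = zero = {Λ}` -/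
def isZero (o : ℕ) : Fml := isSetOf o (isEmpty 0)

/-- `σ = κ⁺ = {x : ∃ z a, z ∈ κ ∧ a ∉ z ∧ x = z ∪ {a}}` -/
def isSucc (σ κ : ℕ) : Fml :=
  isSetOf σ (∃ₛ ∃ₛ (1 ∈ₛ (κ + 3) ⋏ (0 ∈ₛ 1).neg ⋏ isAdjoin 2 1 0))

/-- `s = x + y = {z : ∃ u v, u ∈ x ∧ v ∈ y ∧ u ∩ v = Λ ∧ z = u ∪ v}` -/
def isAdd (s x y : ℕ) : Fml :=
  isSetOf s (∃ₛ ∃ₛ (1 ∈ₛ (x + 3) ⋏ 0 ∈ₛ (y + 3) ⋏ disjoint 1 0 ⋏ isUnion 2 1 0))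

/-- `x ∈ SF`: `x` belongs to every `w` that contains `zero` and is closed under successor. -/
def isSemifinite (x : ℕ) : Fml :=
  ∀ₛ ((∃ₛ (isZero 0 ⋏ 0 ∈ₛ 1)) ⋏ (∀ₛ (0 ∈ₛ 1 ⇒ₛ ∃ₛ (isSucc 0 1 ⋏ 0 ∈ₛ 2)))
    ⇒ₛ (x + 1) ∈ₛ 0)

/-- The closure conditions of the graph of multiplication on `w`: `⟨x, zero, zero⟩ ∈ w` and
`⟨zero, x, zero⟩ ∈ w` for `x ∈ SF`, and `⟨x, y⁺, z + x⟩ ∈ w` whenever `⟨x, y, z⟩ ∈ w`. In the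
third, `x`, `y`, `z`, `y⁺`, `z + x` are the variables `4`, `3`, `2`, `1`, `0`. -/
def mulClosed (w : ℕ) : Fml :=
  (∀ₛ (isSemifinite 0 ⇒ₛ ∃ₛ (isZero 0 ⋏ tripleMem 1 0 0 (w + 2)))) ⋏
  (∀ₛ (isSemifinite 0 ⇒ₛ ∃ₛ (isZero 0 ⋏ tripleMem 0 1 0 (w + 2)))) ⋏
  (∀ₛ ∀ₛ ∀ₛ (tripleMem 2 1 0 (w + 3) ⇒ₛ
    ∃ₛ ∃ₛ (isSucc 1 3 ⋏ isAdd 0 2 4 ⋏ tripleMem 4 1 0 (w + 5))))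

/-- `⟨x, y, z⟩ ∈ 𝔾`, where the graph `𝔾` of multiplication is the intersection of all `w` that
satisfy the closure conditions -/
def mulGraph (x y z : ℕ) : Fml :=
  ∀ₛ (mulClosed 0 ⇒ₛ tripleMem (x + 1) (y + 1) (z + 1) 0)

/-- `m = x · y = {u : ∃ z, ⟨x, y, z⟩ ∈ 𝔾 ∧ u ∈ z}` -/
def isMul (m x y : ℕ) : Fml := isSetOf m (∃ₛ (mulGraph (x + 2) (y + 2) 0 ⋏ 1 ∈ₛ 0))

/-- `P = X × Y`, the set of all `⟨x, y⟩` with `x ∈ X` and `y ∈ Y` -/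
def isProd (P X Y : ℕ) : Fml :=
  isSetOf P (∃ₛ ∃ₛ (1 ∈ₛ (X + 3) ⋏ 0 ∈ₛ (Y + 3) ⋏ isPair 2 1 0))

end INF

open INF

namespace INF

/-! ### Renaming -/

/-! A Kuratowski pair lies two types above its components, exactly as {{x}} lies two types above x.
So {{x}} ↦ ⟨x, b⟩ is a stratified bijection of USC(USC(X)) onto X × {b} (`similar_USC2_prod`), and X
× {b} has cardinal 𝕋²(κ). If b ∉ Y, then X × (Y ∪ {b}) is the disjoint union of X × Y and X × {b}.
Adjoining b to Y therefore takes the successor of 𝕋²(μ) and adds 𝕋²(κ) to the cardinal of the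
product, which is the recursion clause of 𝔾.

Induction on the finite set Y thus puts ⟨𝕋²(κ), 𝕋²(μ), Nc(X × Y)⟩ into every set closed under the
clauses of 𝔾 (`mulGraph_Nc`); the base case needs 𝕋²(κ) ∈ SF (`semifinite_Nc`). Since x · y is the
union of all z with ⟨x, y, z⟩ ∈ 𝔾, every such z must also be bounded. The stratified relation
`mulRel` does this: it satisfies the clauses of 𝔾, hence holds on all of 𝔾 (`mulRel_of_mulGraph`).
It speaks of members of the cardinals only, so 𝔾 need not be shown functional first. The two bounds
meet in `mul_Nc`. Finiteness of X × Y is an induction on Y whose step rests on an induction on X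
(`finite_prod`).

All of this is carried out inside the calculus. Quantifier rules are recast with instances ranging
over actual variables (`Derives.all_of_forall`), and comprehension is used through `exists_setOf`,
where stratification is checked before parameters are substituted. Case distinctions come only from
disjunctions that membership in a union, pair or adjunction supplies, so the argument is
intuitionistic. -/

theorem up_comp (f g : ℕ → ℕ) : up f ∘ up g = up (f ∘ g) := by
  funext n; cases n <;> rfl

theorem up_id : up id = id := by
  funext n; cases n <;> rfl

theorem up_injective {f : ℕ → ℕ} (hf : Function.Injective f) : Function.Injective (up f) := by
  rintro (_ | m) (_ | n) h
  · rfl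
  · simp [up] at h
  · simp [up] at h
  · simp only [up, Nat.add_right_cancel_iff] at h
    rw [hf h]

namespace Fml

theorem rename_rename (φ : Fml) : ∀ f g : ℕ → ℕ,
    (φ.rename g).rename f = φ.rename (f ∘ g) := by
  induction φ with
  | bot => intros; rfl
  | mem | eq => intros; rfl
  | and _ _ h₁ h₂ | or _ _ h₁ h₂ | imp _ _ h₁ h₂ => intro f g; simp only [rename, h₁, h₂]
  | all _ h | ex _ h => intro f g; simp only [rename, h, up_comp]

theorem rename_id (φ : Fml) : φ.rename id = φ := by
  induction φ with
  | bot => rfl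
  | mem | eq => rfl
  | and _ _ h₁ h₂ | or _ _ h₁ h₂ | imp _ _ h₁ h₂ => simp only [rename, h₁, h₂]
  | all _ h | ex _ h => simp only [rename, h, up_id]

theorem inst_rename (φ : Fml) (f : ℕ → ℕ) (t : ℕ) :
    (φ.inst t).rename f = (φ.rename (up f)).inst (f t) := by
  simp only [inst, rename_rename]
  congr 1; funext n; cases n <;> rfl

theorem shift_rename (φ : Fml) (f : ℕ → ℕ) :
    φ.shift.rename (up f) = (φ.rename f).shift := by
  simp only [shift, rename_rename]; rfl

theorem rename_up_inst (φ : Fml) (f : ℕ → ℕ) (t : ℕ) :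
    (φ.rename (up f)).inst t = φ.rename (cons t f) := by
  simp only [inst, rename_rename]
  congr 1; funext n; cases n <;> rfl

/-- Renaming only depends on finitely many values of the renaming function. -/
theorem exists_rename_congr (φ : Fml) :
    ∃ N, ∀ f g : ℕ → ℕ, (∀ n < N, f n = g n) → φ.rename f = φ.rename g := by
  induction φ with
  | bot => exact ⟨0, fun _ _ _ => rfl⟩
  | mem x y | eq x y =>
    refine ⟨max x y + 1, fun f g h => ?_⟩
    simp only [rename, h x (by omega), h y (by omega)]
  | and _ _ h₁ h₂ | or _ _ h₁ h₂ | imp _ _ h₁ h₂ =>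
    obtain ⟨M, hM⟩ := h₁
    obtain ⟨N, hN⟩ := h₂
    refine ⟨max M N, fun f g h => ?_⟩
    simp only [rename, hM f g fun n hn => h n (by omega), hN f g fun n hn => h n (by omega)]
  | all _ h | ex _ h =>
    obtain ⟨N, hN⟩ := h
    refine ⟨N, fun f g h => ?_⟩
    simp only [rename]
    rw [hN (up f) (up g)]
    rintro (_ | n) hn
    · rfl
    · simp only [up, h n (by omega)]

theorem exists_rename_congr_list (Γ : List Fml) :
    ∃ N, ∀ φ ∈ Γ, ∀ f g : ℕ → ℕ, (∀ n < N, f n = g n) → φ.rename f = φ.rename g := by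
  induction Γ with
  | nil => exact ⟨0, by simp⟩
  | cons ψ Γ ih =>
    obtain ⟨M, hM⟩ := ψ.exists_rename_congr
    obtain ⟨N, hN⟩ := ih
    refine ⟨max M N, fun φ hφ f g h => ?_⟩
    rcases List.mem_cons.1 hφ with rfl | hφ
    · exact hM f g fun n hn => h n (by omega)
    · exact hN φ hφ f g fun n hn => h n (by omega)

end Fml

theorem StratBy.rename {φ : Fml} : ∀ {f : ℕ → ℕ} {τ : ℕ → ℕ},
    StratBy (τ ∘ f) φ → StratBy τ (φ.rename f) := by
  have key : ∀ (k : ℕ) (τ f : ℕ → ℕ), cons k (τ ∘ f) = cons k τ ∘ up f := by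
    intro k τ f; funext n; cases n <;> rfl
  induction φ with
  | bot => exact id
  | mem | eq => exact id
  | and _ _ h₁ h₂ | or _ _ h₁ h₂ | imp _ _ h₁ h₂ => exact fun h => ⟨h₁ h.1, h₂ h.2⟩
  | all _ h | ex _ h =>
    rintro f τ ⟨k, hk⟩
    exact ⟨k, h (key k τ f ▸ hk)⟩

/-- A typing of the variables is carried along a left inverse of `f`. Identifying two variables of
different types could destroy stratification, which is why renamings of derivations are first
restricted to injective ones. -/
theorem Stratified.rename {f : ℕ → ℕ} (hf : Function.Injective f) {φ : Fml} :
    Stratified φ → Stratified (φ.rename f) := by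
  rintro ⟨τ, hτ⟩
  refine ⟨τ ∘ Function.invFun f, StratBy.rename (f := f) ?_⟩
  rwa [Function.comp_assoc, Function.invFun_comp hf, Function.comp_id]

theorem IsAxiom.rename {f : ℕ → ℕ} (hf : Function.Injective f) {φ : Fml} (h : IsAxiom φ) :
    IsAxiom (φ.rename f) := by
  cases h with
  | extensionality => exact IsAxiom.extensionality
  | comprehension φ h =>
    have := IsAxiom.comprehension _ (h.rename (up_injective hf))
    convert this using 1
    simp only [isSetOf, Fml.rename, Fml.iff, Fml.rename_rename]
    have e : up (up f) ∘ up (· + 1) = up (· + 1) ∘ up f := by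
      funext n; cases n <;> rfl
    rw [e]; rfl

/-! ### Weakening and injective renaming of derivations. -/

namespace Derives

theorem mono {Γ Δ : List Fml} {φ : Fml} (h : Derives Γ φ) : Γ ⊆ Δ → Derives Δ φ := by
  induction h generalizing Δ with
  | ax h => exact fun _ => ax h
  | hyp h => exact fun s => hyp (s h)
  | botE _ ih => exact fun s => botE (ih s)
  | andI _ _ ih₁ ih₂ => exact fun s => andI (ih₁ s) (ih₂ s)
  | andE₁ _ ih => exact fun s => andE₁ (ih s)
  | andE₂ _ ih => exact fun s => andE₂ (ih s)
  | orI₁ _ ih => exact fun s => orI₁ (ih s)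
  | orI₂ _ ih => exact fun s => orI₂ (ih s)
  | orE _ _ _ ih ih₁ ih₂ =>
    exact fun s => orE (ih s) (ih₁ (List.cons_subset_cons _ s)) (ih₂ (List.cons_subset_cons _ s))
  | impI _ ih => exact fun s => impI (ih (List.cons_subset_cons _ s))
  | impE _ _ ih₁ ih₂ => exact fun s => impE (ih₁ s) (ih₂ s)
  | allI _ ih => exact fun s => allI (ih (List.map_subset _ s))
  | allE t _ ih => exact fun s => allE t (ih s)
  | exI t _ ih => exact fun s => exI t (ih s)
  | exE _ _ ih₁ ih₂ =>
    exact fun s => exE (ih₁ s) (ih₂ (List.cons_subset_cons _ (List.map_subset _ s)))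
  | eqI t => exact fun _ => eqI t
  | eqE φ _ _ ih₁ ih₂ => exact fun s => eqE φ (ih₁ s) (ih₂ s)

theorem map_shift_rename (Γ : List Fml) (f : ℕ → ℕ) :
    (Γ.map Fml.shift).map (Fml.rename (up f)) = (Γ.map (Fml.rename f)).map Fml.shift := by
  simp only [List.map_map]
  exact List.map_congr_left fun φ _ => φ.shift_rename f

theorem rename {Γ : List Fml} {φ : Fml} (h : Derives Γ φ) :
    ∀ {f : ℕ → ℕ}, Function.Injective f → Derives (Γ.map (Fml.rename f)) (φ.rename f) := by
  induction h with
  | ax h => exact fun hf => ax (h.rename hf)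
  | hyp h => exact fun _ => hyp (List.mem_map_of_mem h)
  | botE _ ih => exact fun hf => botE (ih hf)
  | andI _ _ ih₁ ih₂ => exact fun hf => andI (ih₁ hf) (ih₂ hf)
  | andE₁ _ ih => exact fun hf => andE₁ (ih hf)
  | andE₂ _ ih => exact fun hf => andE₂ (ih hf)
  | orI₁ _ ih => exact fun hf => orI₁ (ih hf)
  | orI₂ _ ih => exact fun hf => orI₂ (ih hf)
  | orE _ _ _ ih ih₁ ih₂ => exact fun hf => orE (ih hf) (ih₁ hf) (ih₂ hf)
  | impI _ ih => exact fun hf => impI (ih hf)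
  | impE _ _ ih₁ ih₂ => exact fun hf => impE (ih₁ hf) (ih₂ hf)
  | allI _ ih =>
    intro f hf
    have := ih (up_injective hf)
    rw [map_shift_rename] at this
    exact allI this
  | allE t _ ih =>
    intro f hf
    rw [Fml.inst_rename]
    exact allE _ (ih hf)
  | exI t _ ih =>
    intro f hf
    have := ih hf
    rw [Fml.inst_rename] at this
    exact exI _ this
  | exE _ _ ih₁ ih₂ =>
    intro f hf
    have := ih₂ (up_injective hf)
    rw [List.map_cons, map_shift_rename, Fml.shift_rename] at this
    exact exE (ih₁ hf) this
  | eqI t => exact fun _ => eqI _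
  | eqE φ _ _ ih₁ ih₂ =>
    intro f hf
    have := ih₂ hf
    rw [Fml.inst_rename] at this ⊢
    exact eqE _ (ih₁ hf) this

end Derives

/-! ### Fresh variables: quantifier rules through instances. -/

/-- The injective renaming `t ↦ 0`, `n ↦ n + 1` for `n ≠ t`. -/
def lower (t n : ℕ) : ℕ := if n = t then 0 else n + 1

theorem lower_injective (t : ℕ) : Function.Injective (lower t) := by
  intro m n h
  simp only [lower] at h
  split_ifs at h <;> omega

namespace Fml

theorem rename_lower {φ : Fml} {N t : ℕ} (ht : N ≤ t)
    (h : ∀ f g : ℕ → ℕ, (∀ n < N, f n = g n) → φ.rename f = φ.rename g) :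
    φ.rename (lower t) = φ.shift :=
  h _ _ fun n hn => if_neg (by omega)

theorem inst_rename_lower {φ : Fml} {N t : ℕ} (ht : N ≤ t)
    (h : ∀ f g : ℕ → ℕ, (∀ n < N, f n = g n) → φ.rename f = φ.rename g) :
    (φ.inst t).rename (lower t) = φ := by
  rw [inst, rename_rename]
  refine (h _ id ?_).trans φ.rename_id
  rintro (_ | n) hn
  · exact if_pos rfl
  · exact if_neg (show n ≠ t by omega)

end Fml

/-- The instance at a variable `N` beyond all those occurring is already generic: the injective
renaming `lower N` sends it back to the body and shifts the context, giving the premise of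
`Derives.allI`. Binders can then be handled by ordinary functions on variables. -/
theorem Derives.all_of_forall {Γ : List Fml} {φ : Fml} (h : ∀ t, Derives Γ (φ.inst t)) :
    Derives Γ (∀ₛ φ) := by
  obtain ⟨N, hN⟩ := Fml.exists_rename_congr_list (φ :: Γ)
  have := (h N).rename (lower_injective N)
  rw [Fml.inst_rename_lower le_rfl (hN φ (by simp)), List.map_congr_left fun ψ hψ =>
    Fml.rename_lower le_rfl (hN ψ (List.mem_cons_of_mem _ hψ))] at this
  exact Derives.allI this

theorem Derives.ex_elim_of_forall {Γ : List Fml} {φ χ : Fml} (h : Derives Γ (∃ₛ φ))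
    (k : ∀ t, Derives (φ.inst t :: Γ) χ) : Derives Γ χ := by
  obtain ⟨N, hN⟩ := Fml.exists_rename_congr_list (φ :: χ :: Γ)
  have := (k N).rename (lower_injective N)
  rw [List.map_cons, Fml.inst_rename_lower le_rfl (hN φ (by simp)),
    Fml.rename_lower le_rfl (hN χ (by simp)), List.map_congr_left fun ψ hψ =>
    Fml.rename_lower le_rfl (hN ψ (by simp [hψ]))] at this
  exact Derives.exE h this

/-! ### Renaming of provable formulas by finitely supported, not necessarily injective maps -/

/-- Generalising turns `φ` into `∀ₛ φ`, on which `f` acts below the binder as `up f`; after a shift,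
instantiating at `0` recovers the body. No induction on derivations is involved, so `f` need not be
injective. -/
theorem Provable.rename_up {f : ℕ → ℕ} (hf : ∀ φ, Provable φ → Provable (φ.rename f))
    {φ : Fml} (h : Provable φ) : Provable (φ.rename (up f)) := by
  have h₁ : Provable ((∀ₛ φ).rename f) := hf _ (Derives.allI h)
  have h₂ : Provable (((∀ₛ φ).rename f).rename (· + 1)) :=
    Derives.rename h₁ (add_left_injective 1)
  have h₃ := Derives.allE 0 h₂
  rw [Fml.rename_up_inst, Fml.rename_rename] at h₃
  have e : cons 0 (· + 1) ∘ up f = up f := by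
    funext n; cases n <;> rfl
  rwa [e] at h₃

theorem Provable.rename_cons {f : ℕ → ℕ} (hf : ∀ φ, Provable φ → Provable (φ.rename f)) (t : ℕ)
    {φ : Fml} (h : Provable φ) : Provable (φ.rename (cons t f)) := by
  rw [← Fml.rename_up_inst]
  exact Derives.allE t (Derives.allI (Provable.rename_up hf h))

/-- The assignment that takes the values `l` at the first indices. -/
def asgn : List ℕ → ℕ → ℕ
  | [] => id
  | t :: l => cons t (asgn l)

/-- Parameters may be replaced by arbitrary, even coinciding, variables: each is generalised and
then instantiated, so stratification of the resulting formula is never required. -/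
theorem Provable.rename_asgn (l : List ℕ) {φ : Fml} (h : Provable φ) :
    Provable (φ.rename (asgn l)) := by
  induction l generalizing φ with
  | nil => rwa [asgn, Fml.rename_id]
  | cons t l ih => exact Provable.rename_cons (fun _ => ih) t h

end INF

namespace INF

/-! ### Reasoning in a growing context

`Γ ⊩ φ` says that `φ` is derivable in every context that extends `Γ`. Hypotheses are kept in this
form, so that they remain usable when a rule enlarges the context. -/

notation:30 Γ:31 " ⊢ₛ " φ:30 => Derives Γ φ

/-- `Δ` extends the context `Γ`. -/
class Le (Γ Δ : List Fml) : Prop where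
  sub : Γ ⊆ Δ

-- Composing extensions lets a hypothesis of the form `Γ ⊩ φ` be used in any context reached through
-- several rules.
set_option synthInstance.checkSynthOrder false in
instance (priority := low) Le.trans {Γ Δ Θ : List Fml} [h₁ : Le Δ Θ] [h₂ : Le Γ Δ] : Le Γ Θ :=
  ⟨fun _ h => h₁.sub (h₂.sub h)⟩

instance (priority := high) Le.refl {Γ : List Fml} : Le Γ Γ := ⟨fun _ h => h⟩

abbrev Forces (Γ : List Fml) (φ : Fml) : Prop := ∀ {Δ : List Fml} [Le Γ Δ], Derives Δ φ

notation:30 Γ:31 " ⊩ " φ:30 => Forces Γ φ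

variable {Γ : List Fml} {φ ψ χ : Fml}

theorem Derives.up (h : Γ ⊢ₛ φ) : Γ ⊩ φ := fun {_} i => h.mono i.sub

instance le_cons : Le Γ (φ :: Γ) := ⟨List.subset_cons_self _ _⟩

theorem forces_head : φ :: Γ ⊩ φ := fun {_} i => Derives.hyp (i.sub List.mem_cons_self)

theorem imp_intro (k : ∀ {Δ} [Le Γ Δ], (Δ ⊩ φ) → Δ ⊢ₛ ψ) : Γ ⊢ₛ (φ ⇒ₛ ψ) :=
  Derives.impI (k (Δ := φ :: Γ) (forces_head (Γ := Γ)))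

theorem or_elim (h : Γ ⊢ₛ (φ ⋎ ψ)) (k₁ : ∀ {Δ} [Le Γ Δ], (Δ ⊩ φ) → Δ ⊢ₛ χ)
    (k₂ : ∀ {Δ} [Le Γ Δ], (Δ ⊩ ψ) → Δ ⊢ₛ χ) : Γ ⊢ₛ χ :=
  Derives.orE h (k₁ (Δ := φ :: Γ) (forces_head (Γ := Γ)))
    (k₂ (Δ := ψ :: Γ) (forces_head (Γ := Γ)))

theorem ex_elim (h : Γ ⊢ₛ (∃ₛ φ)) (k : ∀ {Δ} [Le Γ Δ] (t : ℕ), (Δ ⊩ φ.inst t) → Δ ⊢ₛ χ) :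
    Γ ⊢ₛ χ :=
  Derives.ex_elim_of_forall h fun t =>
    k (Δ := φ.inst t :: Γ) t (forces_head (Γ := Γ))

theorem all_intro (h : ∀ t, Γ ⊢ₛ φ.inst t) : Γ ⊢ₛ (∀ₛ φ) := Derives.all_of_forall h

/-- A derived formula may be used as a hypothesis. -/
theorem cut (h : Γ ⊢ₛ φ) (k : (Γ ⊩ φ) → Γ ⊢ₛ χ) : Γ ⊢ₛ χ := k h.up

/-! ### Equality -/

theorem eq_symm {s t : ℕ} (h : Γ ⊩ s ≐ t) : Γ ⊢ₛ t ≐ s :=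
  Derives.eqE (0 ≐ (s + 1)) h (Derives.eqI s)

theorem eq_trans {s t u : ℕ} (h₁ : Γ ⊩ s ≐ t) (h₂ : Γ ⊩ t ≐ u) : Γ ⊢ₛ s ≐ u :=
  Derives.eqE ((s + 1) ≐ 0) h₂ h₁

theorem mem_congr_left {s t z : ℕ} (h : Γ ⊩ s ≐ t) (hs : Γ ⊩ s ∈ₛ z) : Γ ⊢ₛ t ∈ₛ z :=
  Derives.eqE (0 ∈ₛ (z + 1)) h hs

theorem mem_congr_right {s t x : ℕ} (h : Γ ⊩ s ≐ t) (hx : Γ ⊩ x ∈ₛ s) : Γ ⊢ₛ x ∈ₛ t :=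
  Derives.eqE ((x + 1) ∈ₛ 0) h hx

theorem ext {x y : ℕ} (h₁ : ∀ t {Δ} [Le Γ Δ], (Δ ⊩ t ∈ₛ x) → Δ ⊢ₛ t ∈ₛ y)
    (h₂ : ∀ t {Δ} [Le Γ Δ], (Δ ⊩ t ∈ₛ y) → Δ ⊢ₛ t ∈ₛ x) : Γ ⊢ₛ x ≐ y := by
  have h := Derives.allE y (Derives.allE x (Derives.ax (Γ := Γ) IsAxiom.extensionality))
  exact Derives.impE h (all_intro fun t =>
    Derives.andI (imp_intro fun h => h₁ t h) (imp_intro fun h => h₂ t h))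

/-! ### Sets given by comprehension -/

theorem mem_setOf {z : ℕ} (h : Γ ⊩ isSetOf z φ) {t : ℕ} : (Γ ⊢ₛ t ∈ₛ z) ↔ (Γ ⊢ₛ φ.inst t) :=
  have h := Derives.allE t h
  ⟨fun ht => Derives.impE (Derives.andE₁ h) ht, fun ht => Derives.impE (Derives.andE₂ h) ht⟩

theorem setOf_intro {z : ℕ} (h₁ : ∀ t {Δ} [Le Γ Δ], (Δ ⊩ t ∈ₛ z) → Δ ⊢ₛ φ.inst t)
    (h₂ : ∀ t {Δ} [Le Γ Δ], (Δ ⊩ φ.inst t) → Δ ⊢ₛ t ∈ₛ z) : Γ ⊢ₛ isSetOf z φ :=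
  all_intro fun t => Derives.andI (imp_intro fun h => h₁ t h) (imp_intro fun h => h₂ t h)

theorem setOf_unique {y z : ℕ} (hy : Γ ⊩ isSetOf y φ) (hz : Γ ⊩ isSetOf z φ) : Γ ⊢ₛ y ≐ z :=
  ext (fun _ _ _ ht => (mem_setOf hz).2 ((mem_setOf hy).1 ht))
    (fun _ _ _ ht => (mem_setOf hy).2 ((mem_setOf hz).1 ht))

theorem setOf_congr {y z : ℕ} (hy : Γ ⊩ isSetOf y φ) (h : Γ ⊩ y ≐ z) : Γ ⊢ₛ isSetOf z φ :=
  setOf_intro (fun _ _ _ ht => (mem_setOf hy).1 (mem_congr_right (eq_symm h) ht))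
    (fun _ _ _ ht => mem_congr_right h ((mem_setOf hy).2 ht))

/-- Comprehension, for a stratified `φ` with its parameters replaced by the variables `l`. -/
theorem exists_setOf (φ : Fml) (l : List ℕ) (τ : ℕ → ℕ) (hφ : StratBy τ φ)
    (k : ∀ {Δ} [Le Γ Δ] (z : ℕ), (Δ ⊩ isSetOf z (φ.rename (up (asgn l)))) → Δ ⊢ₛ χ) :
    Γ ⊢ₛ χ := by
  have h := Provable.rename_asgn l (Derives.ax (IsAxiom.comprehension φ ⟨τ, hφ⟩))
  have e : ∀ z, (isSetOf 0 (φ.rename (up (· + 1))) |>.rename (up (asgn l)) |>.inst z) =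
      isSetOf z (φ.rename (up (asgn l))) := by
    intro z
    simp only [isSetOf, Fml.rename, Fml.inst, Fml.iff, Fml.rename_rename]
    have : up (point z) ∘ up (up (asgn l)) ∘ up (· + 1) = up (asgn l) := by
      funext n; cases n <;> rfl
    rw [this]; rfl
  refine ex_elim (h.mono (List.nil_subset Γ)) fun {Δ} _ z hz => k z ?_
  exact (e z ▸ (hz : Δ ⊢ₛ _) : Δ ⊢ₛ isSetOf z (φ.rename (up (asgn l)))).up

/-! ### Stratification of the set-theoretic notions -/

section Strat

variable {τ : ℕ → ℕ} {k a f o p s t u v w x y z P X Y : ℕ}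

theorem strat_setOf (hz : τ z = k + 1) (h : StratBy (cons k τ) φ) : StratBy τ (isSetOf z φ) :=
  ⟨k, ⟨hz, h⟩, h, hz⟩

theorem strat_empty (hz : τ z = k + 1) : StratBy τ (isEmpty z) := strat_setOf hz trivial

theorem strat_single (hx : τ x = k) (hz : τ z = k + 1) : StratBy τ (isSingle z x) :=
  strat_setOf hz hx.symm

theorem strat_upair (hx : τ x = k) (hy : τ y = k) (hz : τ z = k + 1) :
    StratBy τ (isUPair z x y) :=
  strat_setOf hz ⟨hx.symm, hy.symm⟩

theorem strat_pair (hx : τ x = k) (hy : τ y = k) (hz : τ z = k + 2) :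
    StratBy τ (isPair z x y) :=
  strat_setOf hz ⟨strat_single hx rfl, strat_upair hx hy rfl⟩

theorem strat_pairMem (hx : τ x = k) (hy : τ y = k) (hf : τ f = k + 3) :
    StratBy τ (pairMem x y f) :=
  ⟨k + 2, strat_pair hx hy rfl, hf⟩

theorem strat_triple (hx : τ x = k) (hy : τ y = k) (hz : τ z = k) (ht : τ t = k + 4) :
    StratBy τ (isTriple t x y z) :=
  ⟨k + 2, k + 1, k + 2, strat_pair hx hy rfl, strat_single hz rfl,
    strat_single (k := k + 1) rfl rfl, strat_pair (k := k + 2) rfl rfl ht⟩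

theorem strat_tripleMem (hx : τ x = k) (hy : τ y = k) (hz : τ z = k) (hw : τ w = k + 5) :
    StratBy τ (tripleMem x y z w) :=
  ⟨k + 4, strat_triple hx hy hz rfl, hw⟩

theorem strat_union (hu : τ u = k + 1) (hv : τ v = k + 1) (hz : τ z = k + 1) :
    StratBy τ (isUnion z u v) :=
  strat_setOf hz ⟨hu, hv⟩

theorem strat_disjoint (hu : τ u = k + 1) (hv : τ v = k + 1) : StratBy τ (disjoint u v) :=
  ⟨k, ⟨hu, hv⟩, trivial⟩

theorem strat_adjoin (hu : τ u = k + 1) (ha : τ a = k) (hw : τ w = k + 1) :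
    StratBy τ (isAdjoin w u a) :=
  strat_setOf hw ⟨hu, ha.symm⟩

theorem strat_similar (hX : τ X = k + 1) (hY : τ Y = k + 1) : StratBy τ (similar X Y) := by
  refine ⟨k + 3, ?_, ⟨?_, ?_⟩, ?_⟩
  · exact ⟨k, hX, k, hY, strat_pairMem rfl rfl rfl, k, ⟨hY, strat_pairMem rfl rfl rfl⟩, rfl⟩
  · exact ⟨k, k, ⟨hY, strat_pairMem rfl rfl rfl⟩, hX⟩
  · exact ⟨k, k, k, ⟨hX, hX, hY, strat_pairMem rfl rfl rfl, strat_pairMem rfl rfl rfl⟩, rfl⟩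
  · exact ⟨k, hY, k, hX, strat_pairMem rfl rfl rfl⟩

theorem strat_USC (hx : τ x = k + 1) (hs : τ s = k + 2) : StratBy τ (isUSC s x) :=
  strat_setOf hs ⟨k, hx, strat_single rfl rfl⟩

theorem strat_prod (hX : τ X = k + 1) (hY : τ Y = k + 1) (hP : τ P = k + 3) :
    StratBy τ (isProd P X Y) :=
  strat_setOf hP ⟨k, k, hX, hY, strat_pair rfl rfl rfl⟩

end Strat

end INF

namespace INF

variable {Γ : List Fml} {φ ψ χ : Fml} {a b f g p q s t u v w x y z X Y Z : ℕ}

/-! ### Existence and elements of basic sets -/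

theorem exists_empty (k : ∀ {Δ} [Le Γ Δ] (z : ℕ), (Δ ⊩ isEmpty z) → Δ ⊢ₛ χ) : Γ ⊢ₛ χ :=
  exists_setOf .bot [] (asgn []) trivial k

theorem exists_single (x : ℕ) (k : ∀ {Δ} [Le Γ Δ] (z : ℕ), (Δ ⊩ isSingle z x) → Δ ⊢ₛ χ) :
    Γ ⊢ₛ χ :=
  exists_setOf (0 ≐ 1) [x] (asgn [0, 0]) rfl k

theorem exists_upair (x y : ℕ) (k : ∀ {Δ} [Le Γ Δ] (z : ℕ), (Δ ⊩ isUPair z x y) → Δ ⊢ₛ χ) :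
    Γ ⊢ₛ χ :=
  exists_setOf (0 ≐ 1 ⋎ 0 ≐ 2) [x, y] (asgn [0, 0, 0]) ⟨rfl, rfl⟩ k

theorem exists_pair (x y : ℕ) (k : ∀ {Δ} [Le Γ Δ] (z : ℕ), (Δ ⊩ isPair z x y) → Δ ⊢ₛ χ) :
    Γ ⊢ₛ χ :=
  exists_setOf (isSingle 0 1 ⋎ isUPair 0 1 2) [x, y] (asgn [1, 0, 0])
    ⟨strat_single rfl rfl, strat_upair rfl rfl rfl⟩ k

theorem exists_union (u v : ℕ) (k : ∀ {Δ} [Le Γ Δ] (z : ℕ), (Δ ⊩ isUnion z u v) → Δ ⊢ₛ χ) :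
    Γ ⊢ₛ χ :=
  exists_setOf (0 ∈ₛ 1 ⋎ 0 ∈ₛ 2) [u, v] (asgn [0, 1, 1]) ⟨rfl, rfl⟩ k

theorem exists_adjoin (u a : ℕ) (k : ∀ {Δ} [Le Γ Δ] (z : ℕ), (Δ ⊩ isAdjoin z u a) → Δ ⊢ₛ χ) :
    Γ ⊢ₛ χ :=
  exists_setOf (0 ∈ₛ 1 ⋎ 0 ≐ 2) [u, a] (asgn [0, 1, 0]) ⟨rfl, rfl⟩ k

theorem exists_prod (X Y : ℕ) (k : ∀ {Δ} [Le Γ Δ] (z : ℕ), (Δ ⊩ isProd z X Y) → Δ ⊢ₛ χ) :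
    Γ ⊢ₛ χ :=
  exists_setOf (∃ₛ ∃ₛ (1 ∈ₛ 3 ⋏ 0 ∈ₛ 4 ⋏ isPair 2 1 0)) [X, Y] (asgn [2, 1, 1])
    ⟨0, 0, rfl, rfl, strat_pair rfl rfl rfl⟩ k

theorem exists_Nc (X : ℕ) (k : ∀ {Δ} [Le Γ Δ] (z : ℕ), (Δ ⊩ isNc z X) → Δ ⊢ₛ χ) :
    Γ ⊢ₛ χ :=
  exists_setOf (similar 0 1) [X] (asgn [1, 1]) (strat_similar rfl rfl) k

theorem exists_zero (k : ∀ {Δ} [Le Γ Δ] (z : ℕ), (Δ ⊩ isZero z) → Δ ⊢ₛ χ) : Γ ⊢ₛ χ :=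
  exists_setOf (isEmpty 0) [] (asgn [1]) (strat_empty rfl) k

theorem exists_USC (X : ℕ) (k : ∀ {Δ} [Le Γ Δ] (z : ℕ), (Δ ⊩ isUSC z X) → Δ ⊢ₛ χ) :
    Γ ⊢ₛ χ :=
  exists_setOf (∃ₛ (0 ∈ₛ 2 ⋏ isSingle 1 0)) [X] (asgn [1, 1]) ⟨0, rfl, strat_single rfl rfl⟩ k

theorem exists_T (κ : ℕ) (k : ∀ {Δ} [Le Γ Δ] (z : ℕ), (Δ ⊩ isT z κ) → Δ ⊢ₛ χ) :
    Γ ⊢ₛ χ :=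
  exists_setOf (∃ₛ (0 ∈ₛ 2 ⋏ ∃ₛ (isUSC 0 1 ⋏ similar 2 0))) [κ] (asgn [2, 2])
    ⟨1, rfl, 2, strat_USC rfl rfl, strat_similar rfl rfl⟩ k

theorem exists_succ (κ : ℕ) (k : ∀ {Δ} [Le Γ Δ] (z : ℕ), (Δ ⊩ isSucc z κ) → Δ ⊢ₛ χ) :
    Γ ⊢ₛ χ :=
  exists_setOf (∃ₛ ∃ₛ (1 ∈ₛ 3 ⋏ (0 ∈ₛ 1).neg ⋏ isAdjoin 2 1 0)) [κ] (asgn [1, 2])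
    ⟨1, 0, rfl, ⟨rfl, trivial⟩, strat_adjoin rfl rfl rfl⟩ k

theorem exists_add (x y : ℕ) (k : ∀ {Δ} [Le Γ Δ] (z : ℕ), (Δ ⊩ isAdd z x y) → Δ ⊢ₛ χ) :
    Γ ⊢ₛ χ :=
  exists_setOf (∃ₛ ∃ₛ (1 ∈ₛ 3 ⋏ 0 ∈ₛ 4 ⋏ disjoint 1 0 ⋏ isUnion 2 1 0)) [x, y] (asgn [1, 2, 2])
    ⟨1, 1, rfl, rfl, strat_disjoint rfl rfl, strat_union rfl rfl rfl⟩ k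

theorem not_mem_empty (h : Γ ⊩ isEmpty z) (ht : Γ ⊩ t ∈ₛ z) : Γ ⊢ₛ χ :=
  .botE ((mem_setOf h).1 ht)

theorem mem_single (h : Γ ⊩ isSingle z x) : (Γ ⊢ₛ t ∈ₛ z) ↔ (Γ ⊢ₛ t ≐ x) := mem_setOf h

theorem mem_upair (h : Γ ⊩ isUPair z x y) : (Γ ⊢ₛ t ∈ₛ z) ↔ (Γ ⊢ₛ t ≐ x ⋎ t ≐ y) := mem_setOf h

theorem mem_pair (h : Γ ⊩ isPair z x y) :
    (Γ ⊢ₛ t ∈ₛ z) ↔ (Γ ⊢ₛ isSingle t x ⋎ isUPair t x y) := mem_setOf h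

theorem mem_union (h : Γ ⊩ isUnion z u v) : (Γ ⊢ₛ t ∈ₛ z) ↔ (Γ ⊢ₛ t ∈ₛ u ⋎ t ∈ₛ v) := mem_setOf h

theorem mem_adjoin (h : Γ ⊩ isAdjoin z u a) : (Γ ⊢ₛ t ∈ₛ z) ↔ (Γ ⊢ₛ t ∈ₛ u ⋎ t ≐ a) := mem_setOf h

theorem mem_Nc (h : Γ ⊩ isNc z X) : (Γ ⊢ₛ t ∈ₛ z) ↔ (Γ ⊢ₛ similar t X) := mem_setOf h

theorem mem_zero (h : Γ ⊩ isZero z) : (Γ ⊢ₛ t ∈ₛ z) ↔ (Γ ⊢ₛ isEmpty t) := mem_setOf h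

theorem mem_prod_intro (h : Γ ⊩ isProd z X Y) (hx : Γ ⊩ x ∈ₛ X) (hy : Γ ⊩ y ∈ₛ Y)
    (ht : Γ ⊩ isPair t x y) : Γ ⊢ₛ t ∈ₛ z :=
  (mem_setOf h).2 (.exI x (.exI y (.andI hx (.andI hy ht))))

theorem mem_prod_elim (h : Γ ⊩ isProd z X Y) (ht : Γ ⊩ t ∈ₛ z)
    (k : ∀ {Δ} [Le Γ Δ] (x y : ℕ), (Δ ⊩ x ∈ₛ X) → (Δ ⊩ y ∈ₛ Y) → (Δ ⊩ isPair t x y) → Δ ⊢ₛ χ) :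
    Γ ⊢ₛ χ := by
  refine ex_elim ((mem_setOf h).1 ht) fun x h => ex_elim h fun y h => k x y ?_ ?_ ?_
  exacts [h.andE₁, h.andE₂.andE₁, h.andE₂.andE₂]

theorem mem_USC_intro (h : Γ ⊩ isUSC z X) (hx : Γ ⊩ x ∈ₛ X) (ht : Γ ⊩ isSingle t x) :
    Γ ⊢ₛ t ∈ₛ z :=
  (mem_setOf h).2 (.exI x (.andI hx ht))

theorem mem_USC_elim (h : Γ ⊩ isUSC z X) (ht : Γ ⊩ t ∈ₛ z)
    (k : ∀ {Δ} [Le Γ Δ] (x : ℕ), (Δ ⊩ x ∈ₛ X) → (Δ ⊩ isSingle t x) → Δ ⊢ₛ χ) : Γ ⊢ₛ χ := by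
  refine ex_elim ((mem_setOf h).1 ht) fun x h => k x ?_ ?_
  exacts [h.andE₁, h.andE₂]

theorem mem_T_elim (h : Γ ⊩ isT z X) (ht : Γ ⊩ t ∈ₛ z)
    (k : ∀ {Δ} [Le Γ Δ] (x s : ℕ), (Δ ⊩ x ∈ₛ X) → (Δ ⊩ isUSC s x) → (Δ ⊩ similar t s) → Δ ⊢ₛ χ) :
    Γ ⊢ₛ χ := by
  refine ex_elim ((mem_setOf h).1 ht) fun x h => ex_elim h.andE₂ fun s h' => k x s ?_ ?_ ?_
  exacts [h.andE₁, h'.andE₁, h'.andE₂]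

theorem mem_T_intro (h : Γ ⊩ isT z X) (hx : Γ ⊩ x ∈ₛ X) (hs : Γ ⊩ isUSC s x)
    (ht : Γ ⊩ similar t s) : Γ ⊢ₛ t ∈ₛ z :=
  (mem_setOf h).2 (.exI x (.andI hx (.exI s (.andI hs ht))))

theorem mem_succ_elim (h : Γ ⊩ isSucc z x) (ht : Γ ⊩ t ∈ₛ z)
    (k : ∀ {Δ} [Le Γ Δ] (u a : ℕ), (Δ ⊩ u ∈ₛ x) → (Δ ⊩ (a ∈ₛ u).neg) → (Δ ⊩ isAdjoin t u a) →
      Δ ⊢ₛ χ) : Γ ⊢ₛ χ := by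
  refine ex_elim ((mem_setOf h).1 ht) fun x h => ex_elim h fun y h => k x y ?_ ?_ ?_
  exacts [h.andE₁, h.andE₂.andE₁, h.andE₂.andE₂]

theorem mem_add_elim (h : Γ ⊩ isAdd z x y) (ht : Γ ⊩ t ∈ₛ z)
    (k : ∀ {Δ} [Le Γ Δ] (u v : ℕ), (Δ ⊩ u ∈ₛ x) → (Δ ⊩ v ∈ₛ y) → (Δ ⊩ disjoint u v) →
      (Δ ⊩ isUnion t u v) → Δ ⊢ₛ χ) : Γ ⊢ₛ χ := by
  refine ex_elim ((mem_setOf h).1 ht) fun x h => ex_elim h fun y h => k x y ?_ ?_ ?_ ?_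
  exacts [h.andE₁, h.andE₂.andE₁, h.andE₂.andE₂.andE₁, h.andE₂.andE₂.andE₂]

theorem not_mem_of_disjoint (h : Γ ⊩ disjoint u v) (hu : Γ ⊩ t ∈ₛ u) (hv : Γ ⊩ t ∈ₛ v) :
    Γ ⊢ₛ χ :=
  .botE (.impE (.allE t h) (.andI hu hv))

theorem disjoint_intro
    (h : ∀ {Δ} [Le Γ Δ] (t : ℕ), (Δ ⊩ t ∈ₛ u) → (Δ ⊩ t ∈ₛ v) → Δ ⊢ₛ Fml.bot) :
    Γ ⊢ₛ disjoint u v :=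
  all_intro fun t => imp_intro fun i => h t i.andE₁ i.andE₂

theorem neg_intro (h : ∀ {Δ} [Le Γ Δ], (Δ ⊩ φ) → Δ ⊢ₛ Fml.bot) : Γ ⊢ₛ φ.neg := imp_intro h

theorem neg_elim (h : Γ ⊩ φ.neg) (h' : Γ ⊩ φ) : Γ ⊢ₛ χ := .botE (.impE h h')

/-! ### Ordered pairs and triples -/

theorem single_inj (h : Γ ⊩ isSingle z x) (h' : Γ ⊩ isSingle z y) : Γ ⊢ₛ x ≐ y :=
  (mem_single h').1 ((mem_single h).2 (.eqI x))

theorem single_congr (h : Γ ⊩ isSingle z x) (h' : Γ ⊩ x ≐ y) : Γ ⊢ₛ isSingle z y :=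
  .eqE (isSingle (z + 1) 0) h' h

theorem pair_congr (h : Γ ⊩ isPair p x y) (hx : Γ ⊩ x ≐ a) (hy : Γ ⊩ y ≐ b) :
    Γ ⊢ₛ isPair p a b :=
  .eqE (isPair (p + 1) (a + 1) 0) hy (.eqE (isPair (p + 1) 0 (y + 1)) hx h)

theorem pair_inj_left (h : Γ ⊩ isPair p x y) (h' : Γ ⊩ isPair p a b) : Γ ⊢ₛ x ≐ a := by
  refine exists_single x fun s hs => ?_
  refine or_elim ((mem_pair h').1 ((mem_pair h).2 (.orI₁ hs))) (fun i => single_inj hs i)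
    fun i => ?_
  exact eq_symm ((mem_single hs).1 ((mem_upair i).2 (.orI₁ (.eqI a))))

/-- Once the first components are identified, {x, y} is compared with the members of the other pair.
If it equals {x}, then y = x and the symmetric comparison of {x, b} gives b = x; otherwise {x, y} =
{x, b}. Each case is read off from a disjunction. -/
theorem pair_inj_right (h : Γ ⊩ isPair p x y) (h' : Γ ⊩ isPair p a b) : Γ ⊢ₛ y ≐ b := by
  refine cut (pair_congr h' (eq_symm (pair_inj_left h h')) (.eqI b)) fun h' => ?_
  refine exists_upair x y fun s hs => ?_
  refine cut ((mem_upair hs).2 (.orI₂ (.eqI y))) fun hy => ?_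
  refine or_elim ((mem_pair h').1 ((mem_pair h).2 (.orI₂ hs))) (fun i => ?_) fun i => ?_
  · refine cut ((mem_single i).1 hy) fun hyx => ?_
    refine exists_upair x b fun t ht => ?_
    refine cut ((mem_upair ht).2 (.orI₂ (.eqI b))) fun hb => ?_
    refine or_elim ((mem_pair h).1 ((mem_pair h').2 (.orI₂ ht))) (fun j => ?_) fun j => ?_
    · exact eq_trans hyx (eq_symm ((mem_single j).1 hb))
    · exact or_elim ((mem_upair j).1 hb) (fun e => eq_trans hyx (eq_symm e)) fun e => eq_symm e
  · refine or_elim ((mem_upair i).1 hy) (fun e => ?_) fun e => e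
    refine or_elim ((mem_upair hs).1 ((mem_upair i).2 (.orI₂ (.eqI b)))) (fun e' => ?_)
      fun e' => eq_symm e'
    exact eq_trans e (eq_symm e')

theorem pairMem_intro (h : Γ ⊩ isPair p x y) (hp : Γ ⊩ p ∈ₛ f) : Γ ⊢ₛ pairMem x y f :=
  .exI p (.andI h hp)

theorem pairMem_elim (h : Γ ⊩ pairMem x y f)
    (k : ∀ {Δ} [Le Γ Δ] (p : ℕ), (Δ ⊩ isPair p x y) → (Δ ⊩ p ∈ₛ f) → Δ ⊢ₛ χ) : Γ ⊢ₛ χ :=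
  ex_elim h fun p h => k p h.andE₁ h.andE₂

theorem pairMem_congr (h : Γ ⊩ pairMem x y f) (hx : Γ ⊩ x ≐ a) (hy : Γ ⊩ y ≐ b) :
    Γ ⊢ₛ pairMem a b f :=
  .eqE (pairMem (a + 1) 0 (f + 1)) hy (.eqE (pairMem 0 (y + 1) (f + 1)) hx h)

/-- The relation given by a stratified formula, whose variables `1` and `0` are its arguments and
whose parameters are replaced by the variables `l`. -/
theorem exists_rel (ρ : Fml) (l : List ℕ) (τ : ℕ → ℕ) (hρ : StratBy τ ρ) (hτ : τ 0 = τ 1)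
    (k : ∀ {Δ} [Le Γ Δ] (f : ℕ), (∀ {Θ} [Le Δ Θ] {x y : ℕ},
      (Θ ⊢ₛ pairMem x y f) ↔ (Θ ⊢ₛ ρ.rename (asgn (y :: x :: l)))) → Δ ⊢ₛ χ) : Γ ⊢ₛ χ := by
  -- The set of all ⟨a, b⟩ with ρ(a, b). The renaming makes room for the pair itself, typed two
  -- above its components; these must share a type, which is `hτ`.
  refine exists_setOf (∃ₛ ∃ₛ (isPair 2 1 0 ⋏ ρ.rename (up (up (· + 1))))) l
    (cons (τ 0 + 2) fun n => τ (n + 2)) ⟨τ 0, τ 0, strat_pair rfl rfl rfl, StratBy.rename ?_⟩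
    fun f hf => k f @fun Θ _ x y => ?_
  · convert hρ using 1
    funext n
    rcases n with _ | _ | n
    exacts [rfl, hτ, rfl]
  have e : ∀ p x y, ((((ρ.rename (up (up (· + 1)))).rename (up (up (up (asgn l))))).rename
      (up (up (point p)))).rename (up (point x))).rename (point y) =
      ρ.rename (asgn (y :: x :: l)) := by
    intro p x y
    simp only [Fml.rename_rename]
    congr 1
    funext n
    rcases n with _ | _ | n <;> rfl
  constructor
  · intro h
    refine pairMem_elim h.up fun p hp hpf => ?_
    refine ex_elim ((mem_setOf hf).1 hpf) fun {Δ} _ a h => ex_elim h fun {Δ} _ b h => ?_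
    have h₂ : Δ ⊢ₛ ρ.rename (asgn (b :: a :: l)) := e p a b ▸ (h.andE₂ : Δ ⊢ₛ _)
    refine cut h.andE₁ fun h₁ => ?_
    -- The components a, b found for the pair are replaced by x, y one at a time; each time ρ is
    -- written with the variable to be replaced as index `0`.
    have h₃ : Δ ⊢ₛ ρ.rename (asgn (y :: a :: l)) := by
      have := Derives.eqE (ρ.rename (up (asgn (a :: l)))) (pair_inj_right h₁ hp)
        (by rw [Fml.rename_up_inst]; exact h₂)
      rwa [Fml.rename_up_inst] at this
    have e' : ∀ c, (ρ.rename (cons (y + 1) (up (asgn l)))).inst c =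
        ρ.rename (asgn (y :: c :: l)) := by
      intro c
      rw [Fml.inst, Fml.rename_rename]
      congr 1
      funext n
      rcases n with _ | _ | n <;> rfl
    rw [← e']
    exact .eqE _ (pair_inj_left h₁ hp) (e' a ▸ h₃)
  · intro h
    -- The pair variable does not occur in ρ, so any value, here `0`, may stand for it until the
    -- pair is chosen.
    rw [← e 0] at h
    refine exists_pair x y fun p hp => pairMem_intro hp ((mem_setOf hf).2 ?_)
    exact .exI x (.exI y (.andI hp (e p x y ▸ e 0 x y ▸ h.up)))

end INF

namespace INF

variable {Γ : List Fml} {φ ψ χ : Fml} {a b f g p q s t u v w x y z A B P Q U V X Y Z : ℕ}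
  {R S : ℕ → ℕ → Fml}

/-! ### Bijections -/

/-- The relation `R` is a bijection between `X` and `Y` in all contexts that extend `Γ`. -/
structure Bij (Γ : List Fml) (X Y : ℕ) (R : ℕ → ℕ → Fml) : Prop where
  total : ∀ {Δ} [Le Γ Δ] {x χ}, (Δ ⊩ x ∈ₛ X) →
    (∀ {Θ} [Le Δ Θ] y, (Θ ⊩ y ∈ₛ Y) → (Θ ⊩ R x y) → Θ ⊢ₛ χ) → Δ ⊢ₛ χ
  surj : ∀ {Δ} [Le Γ Δ] {y χ}, (Δ ⊩ y ∈ₛ Y) →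
    (∀ {Θ} [Le Δ Θ] x, (Θ ⊩ x ∈ₛ X) → (Θ ⊩ R x y) → Θ ⊢ₛ χ) → Δ ⊢ₛ χ
  func : ∀ {Δ} [Le Γ Δ] {x y z}, (Δ ⊩ x ∈ₛ X) → (Δ ⊩ y ∈ₛ Y) → (Δ ⊩ z ∈ₛ Y) →
    (Δ ⊩ R x y) → (Δ ⊩ R x z) → Δ ⊢ₛ y ≐ z
  inj : ∀ {Δ} [Le Γ Δ] {x z y}, (Δ ⊩ x ∈ₛ X) → (Δ ⊩ z ∈ₛ X) → (Δ ⊩ y ∈ₛ Y) →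
    (Δ ⊩ R x y) → (Δ ⊩ R z y) → Δ ⊢ₛ x ≐ z

theorem Bij.symm (h : Bij Γ X Y R) : Bij Γ Y X fun y x => R x y where
  total := h.surj
  surj := h.total
  func hx hy hz := h.inj hy hz hx
  inj hx hy hz := h.func hz hx hy

theorem similar_elim (h : Γ ⊩ similar X Y)
    (k : ∀ {Δ} [Le Γ Δ] f, Bij Δ X Y (fun x y => pairMem x y f) → Δ ⊢ₛ χ) : Γ ⊢ₛ χ := by
  refine ex_elim h fun {Δ} _ f hf => k f ?_
  have h₁ : Δ ⊩ maps f X Y := hf.andE₁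
  have h₂ : Δ ⊩ oneToOne f X Y := hf.andE₂.andE₁
  have h₃ : Δ ⊩ onto f X Y := hf.andE₂.andE₂
  refine ⟨fun {_} _ x χ hx k => ?_, fun {_} _ y χ hy k => ?_, fun {_} _ x y z hx hy hz i j => ?_,
    fun {_} _ x z y hx hz hy i j => ?_⟩
  · exact ex_elim (.impE (.allE x h₁) hx) fun y h => k y h.andE₁ h.andE₂.andE₁
  · exact ex_elim (.impE (.allE y h₃) hy) fun x h => k x h.andE₁ h.andE₂
  · refine ex_elim (.impE (.allE x h₁) hx) fun {Θ} _ c h => ?_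
    have h' : ∀ t, (Θ ⊩ t ∈ₛ Y) → (Θ ⊩ pairMem x t f) → Θ ⊢ₛ t ≐ c := fun t h₁ h₂ =>
      .impE (.allE t h.andE₂.andE₂) (.andI h₁ h₂)
    exact eq_trans (h' y hy i).up (eq_symm (h' z hz j).up)
  · exact .impE (.allE y (.allE z (.allE x h₂.andE₂)))
      (.andI hx (.andI hz (.andI hy (.andI i j))))

/-- Sets with a bijection given by a stratified formula are similar. In the formula, the variables
`1` and `0` are the arguments, `2` and `3` are `X` and `Y`. -/
theorem Bij.similar (h : Bij Γ X Y R) (ρ : Fml) (l : List ℕ) (τ : ℕ → ℕ) (hρ : StratBy τ ρ)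
    {k : ℕ} (h₀ : τ 0 = k) (h₁ : τ 1 = k) (h₂ : τ 2 = k + 1) (h₃ : τ 3 = k + 1)
    (hR : ∀ x y, ρ.rename (asgn (y :: x :: X :: Y :: l)) = R x y) : Γ ⊢ₛ similar X Y := by
  -- The relation is cut down to X × Y, because one-to-one also demands that a pair of `f` with
  -- second component in Y have its first component in X.
  refine exists_rel (1 ∈ₛ 2 ⋏ 0 ∈ₛ 3 ⋏ ρ) (X :: Y :: l) τ ⟨?_, ?_, hρ⟩ (h₀.trans h₁.symm)
    fun {Δ} _ f hf => ?_
  · rw [StratBy, h₁, h₂]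
  · rw [StratBy, h₀, h₃]
  replace hf : ∀ {Θ} [Le Δ Θ] {x y}, (Θ ⊢ₛ pairMem x y f) ↔ (Θ ⊢ₛ (x ∈ₛ X ⋏ y ∈ₛ Y ⋏ R x y)) := by
    intro Θ _ x y
    rw [hf, ← hR]
    rfl
  refine .exI f (.andI ?_ (.andI (.andI ?_ ?_) ?_))
  · refine all_intro fun x => imp_intro fun hx => h.total hx fun y hy i => .exI y (.andI hy ?_)
    refine .andI (hf.2 (.andI hx (.andI hy i))) (all_intro fun z => imp_intro fun j => ?_)
    exact h.func hx j.andE₁ hy (hf.1 j.andE₂).andE₂.andE₂ i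
  · exact all_intro fun x => all_intro fun y => imp_intro fun j => (hf.1 j.andE₂).andE₁
  · refine all_intro fun x => all_intro fun z => all_intro fun y => imp_intro fun j => ?_
    exact h.inj j.andE₁ j.andE₂.andE₁ j.andE₂.andE₂.andE₁
      (hf.1 j.andE₂.andE₂.andE₂.andE₁).andE₂.andE₂ (hf.1 j.andE₂.andE₂.andE₂.andE₂).andE₂.andE₂
  · refine all_intro fun y => imp_intro fun hy => h.surj hy fun x hx i => .exI x (.andI hx ?_)
    exact hf.2 (.andI hx (.andI hy i))

theorem similar_refl (X : ℕ) : Γ ⊢ₛ similar X X := by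
  have h : Bij Γ X X fun x y => x ≐ y :=
    ⟨fun {_} _ x _ hx k => k x hx (.eqI x), fun {_} _ x _ hx k => k x hx (.eqI x),
      fun _ _ _ i j => eq_trans (eq_symm i) j, fun _ _ _ i j => eq_trans i (eq_symm j)⟩
  exact h.similar (1 ≐ 0) [] (asgn [0, 0, 1, 1]) rfl rfl rfl rfl rfl fun _ _ => rfl

theorem similar_symm (h : Γ ⊩ similar X Y) : Γ ⊢ₛ similar Y X :=
  similar_elim h fun f hf => hf.symm.similar (pairMem 0 1 4) [f] (asgn [0, 0, 1, 1, 3])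
    (strat_pairMem rfl rfl rfl) rfl rfl rfl rfl fun _ _ => rfl

theorem similar_trans (h : Γ ⊩ similar X Y) (h' : Γ ⊩ similar Y Z) : Γ ⊢ₛ similar X Z := by
  refine similar_elim h fun f hf => similar_elim h' fun {Δ} _ g hg => ?_
  have h : Bij Δ X Z fun x z =>
      ∃ₛ (0 ∈ₛ (Y + 1) ⋏ pairMem (x + 1) 0 (f + 1) ⋏ pairMem 0 (z + 1) (g + 1)) := by
    refine ⟨fun {_} _ x χ hx k => ?_, fun {_} _ z χ hz k => ?_, fun {_} _ x z z' hx hz hz' i j => ?_,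
      fun {_} _ x x' z hx hx' hz i j => ?_⟩
    · exact hf.total hx fun y hy i => hg.total hy fun z hz j =>
        k z hz (.exI y (.andI hy (.andI i j)))
    · exact hg.surj hz fun y hy j => hf.surj hy fun x hx i =>
        k x hx (.exI y (.andI hy (.andI i j)))
    · refine ex_elim i fun y i => ex_elim j fun y' j => ?_
      refine cut (hf.func hx i.andE₁ j.andE₁ i.andE₂.andE₁ j.andE₂.andE₁) fun e => ?_
      exact hg.func j.andE₁ hz hz' (pairMem_congr i.andE₂.andE₂ e (.eqI z)) j.andE₂.andE₂
    · refine ex_elim i fun y i => ex_elim j fun y' j => ?_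
      refine cut (hg.inj i.andE₁ j.andE₁ hz i.andE₂.andE₂ j.andE₂.andE₂) fun e => ?_
      exact hf.inj hx hx' j.andE₁ (pairMem_congr i.andE₂.andE₁ (.eqI x) e) j.andE₂.andE₁
  exact h.similar (∃ₛ (0 ∈ₛ 5 ⋏ pairMem 2 0 6 ⋏ pairMem 0 1 7)) [Y, f, g]
    (asgn [0, 0, 1, 1, 1, 3, 3])
    ⟨0, rfl, strat_pairMem rfl rfl rfl, strat_pairMem rfl rfl rfl⟩ rfl rfl rfl rfl fun _ _ => rfl

/-! ### Gluing and splitting bijections. -/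

theorem similar_of_empty (hX : Γ ⊩ isEmpty X) (hY : Γ ⊩ isEmpty Y) : Γ ⊢ₛ similar X Y := by
  refine cut (setOf_unique hX hY) fun e => ?_
  exact .eqE (similar (X + 1) 0) e (similar_refl X)

theorem empty_intro (h : ∀ {Δ} [Le Γ Δ] t, (Δ ⊩ t ∈ₛ X) → Δ ⊢ₛ Fml.bot) : Γ ⊢ₛ isEmpty X :=
  setOf_intro (fun t _ _ ht => h t ht) fun _ _ _ ht => .botE ht

theorem empty_of_similar (hY : Γ ⊩ isEmpty Y) (h : Γ ⊩ similar X Y) : Γ ⊢ₛ isEmpty X :=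
  similar_elim h fun _ hf => empty_intro fun _ ht => hf.total ht fun _ hy _ => not_mem_empty hY hy

theorem similar_single (hA : Γ ⊩ isSingle A a) (hB : Γ ⊩ isSingle B b) : Γ ⊢ₛ similar A B := by
  -- Between singletons the everywhere true relation is a bijection.
  have h : Bij Γ A B fun _ _ => .bot ⇒ₛ .bot := by
    refine ⟨fun {_} _ x χ _ k => k b ((mem_single hB).2 (.eqI b)) (imp_intro fun i => i),
      fun {_} _ x χ _ k => k a ((mem_single hA).2 (.eqI a)) (imp_intro fun i => i),
      fun _ hy hz _ _ => ?_, fun hx hz _ _ _ => ?_⟩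
    · exact eq_trans ((mem_single hB).1 hy) (eq_symm ((mem_single hB).1 hz))
    · exact eq_trans ((mem_single hA).1 hx) (eq_symm ((mem_single hA).1 hz))
  exact h.similar (.bot ⇒ₛ .bot) [] (asgn [0, 0, 1, 1]) ⟨trivial, trivial⟩ rfl rfl rfl rfl
    fun _ _ => rfl

/-- The two bijections are glued, each restricted to its own pieces. Disjointness of p, q excludes
the mixed cases for functionality, disjointness of P, Q those for injectivity. -/
theorem similar_union (hp : Γ ⊩ similar p P) (hq : Γ ⊩ similar q Q) (hd : Γ ⊩ disjoint p q)
    (hD : Γ ⊩ disjoint P Q) (hu : Γ ⊩ isUnion u p q) (hU : Γ ⊩ isUnion U P Q) :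
    Γ ⊢ₛ similar u U := by
  refine similar_elim hp fun f hf => similar_elim hq fun {Δ} _ g hg => ?_
  have h : Bij Δ u U fun x y => (x ∈ₛ p ⋏ y ∈ₛ P ⋏ pairMem x y f) ⋎
      (x ∈ₛ q ⋏ y ∈ₛ Q ⋏ pairMem x y g) := by
    refine ⟨fun {_} _ x χ hx k => ?_, fun {_} _ y χ hy k => ?_, fun {_} _ x y z _ _ _ i j => ?_,
      fun {_} _ x z y _ _ _ i j => ?_⟩
    · refine or_elim ((mem_union hu).1 hx) (fun hx => hf.total hx fun y hy i => ?_)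
        fun hx => hg.total hx fun y hy i => ?_
      · exact k y ((mem_union hU).2 (.orI₁ hy)) (.orI₁ (.andI hx (.andI hy i)))
      · exact k y ((mem_union hU).2 (.orI₂ hy)) (.orI₂ (.andI hx (.andI hy i)))
    · refine or_elim ((mem_union hU).1 hy) (fun hy => hf.surj hy fun x hx i => ?_)
        fun hy => hg.surj hy fun x hx i => ?_
      · exact k x ((mem_union hu).2 (.orI₁ hx)) (.orI₁ (.andI hx (.andI hy i)))
      · exact k x ((mem_union hu).2 (.orI₂ hx)) (.orI₂ (.andI hx (.andI hy i)))
    · refine or_elim i (fun i => or_elim j (fun j => ?_) fun j => ?_)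
        fun i => or_elim j (fun j => ?_) fun j => ?_
      · exact hf.func i.andE₁ i.andE₂.andE₁ j.andE₂.andE₁ i.andE₂.andE₂ j.andE₂.andE₂
      · exact not_mem_of_disjoint hd i.andE₁ j.andE₁
      · exact not_mem_of_disjoint hd j.andE₁ i.andE₁
      · exact hg.func i.andE₁ i.andE₂.andE₁ j.andE₂.andE₁ i.andE₂.andE₂ j.andE₂.andE₂
    · refine or_elim i (fun i => or_elim j (fun j => ?_) fun j => ?_)
        fun i => or_elim j (fun j => ?_) fun j => ?_
      · exact hf.inj i.andE₁ j.andE₁ i.andE₂.andE₁ i.andE₂.andE₂ j.andE₂.andE₂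
      · exact not_mem_of_disjoint hD i.andE₂.andE₁ j.andE₂.andE₁
      · exact not_mem_of_disjoint hD j.andE₂.andE₁ i.andE₂.andE₁
      · exact hg.inj i.andE₁ j.andE₁ i.andE₂.andE₁ i.andE₂.andE₂ j.andE₂.andE₂
  exact h.similar ((1 ∈ₛ 4 ⋏ 0 ∈ₛ 5 ⋏ pairMem 1 0 6) ⋎ (1 ∈ₛ 7 ⋏ 0 ∈ₛ 8 ⋏ pairMem 1 0 9))
    [p, P, f, q, Q, g] (asgn [0, 0, 1, 1, 1, 1, 3, 1, 1, 3])
    ⟨⟨rfl, rfl, strat_pairMem rfl rfl rfl⟩, rfl, rfl, strat_pairMem rfl rfl rfl⟩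
    rfl rfl rfl rfl fun _ _ => rfl

/-- The inverse image of a subset under a bijection. -/
theorem exists_preimage (hf : Bij Γ u U fun x y => pairMem x y f)
    (hP : ∀ {Δ} [Le Γ Δ] t, (Δ ⊩ t ∈ₛ P) → Δ ⊢ₛ t ∈ₛ U)
    (k : ∀ {Δ} [Le Γ Δ] p, (∀ {Θ} [Le Δ Θ] {x y}, (Θ ⊩ y ∈ₛ P) → (Θ ⊩ x ∈ₛ u) →
        (Θ ⊩ pairMem x y f) → Θ ⊢ₛ x ∈ₛ p) →
      (∀ {Θ} [Le Δ Θ] {x χ}, (Θ ⊩ x ∈ₛ p) → (∀ {Ξ} [Le Θ Ξ] y, (Ξ ⊩ y ∈ₛ P) → (Ξ ⊩ x ∈ₛ u) →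
        (Ξ ⊩ pairMem x y f) → Ξ ⊢ₛ χ) → Θ ⊢ₛ χ) →
      (Δ ⊩ similar p P) → Δ ⊢ₛ χ) : Γ ⊢ₛ χ := by
  refine exists_setOf (∃ₛ (0 ∈ₛ 2 ⋏ 1 ∈ₛ 3 ⋏ pairMem 1 0 4)) [P, u, f] (asgn [0, 1, 1, 3])
    ⟨0, rfl, rfl, strat_pairMem rfl rfl rfl⟩ fun {Δ} _ p hp => ?_
  have hi : ∀ {Θ} [Le Δ Θ] {x y}, (Θ ⊩ y ∈ₛ P) → (Θ ⊩ x ∈ₛ u) →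
      (Θ ⊩ pairMem x y f) → Θ ⊢ₛ x ∈ₛ p := fun {_} _ x y hy hx i =>
    (mem_setOf hp).2 (.exI y (.andI hy (.andI hx i)))
  have he : ∀ {Θ} [Le Δ Θ] {x χ}, (Θ ⊩ x ∈ₛ p) → (∀ {Ξ} [Le Θ Ξ] y, (Ξ ⊩ y ∈ₛ P) →
      (Ξ ⊩ x ∈ₛ u) → (Ξ ⊩ pairMem x y f) → Ξ ⊢ₛ χ) → Θ ⊢ₛ χ := fun {_} _ x χ hx k =>
    ex_elim ((mem_setOf hp).1 hx) fun y h => k y h.andE₁ h.andE₂.andE₁ h.andE₂.andE₂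
  have h : Bij Δ p P fun x y => pairMem x y f := by
    refine ⟨fun {_} _ x χ hx k => he hx fun y hy _ i => k y hy i, fun {_} _ y χ hy k => ?_,
      fun {_} _ x y z hx hy hz i j => ?_, fun {_} _ x z y hx hz hy i j => ?_⟩
    · exact hf.surj (hP y hy) fun x hx i => k x (hi hy hx i) i
    · exact he hx fun _ _ hx _ => hf.func hx (hP y hy) (hP z hz) i j
    · exact he hx fun _ _ hx _ => he hz fun _ _ hz _ => hf.inj hx hz (hP y hy) i j
  refine k p hi he ?_
  exact (h.similar (pairMem 1 0 4) [f] (asgn [0, 0, 1, 1, 3])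
    (strat_pairMem rfl rfl rfl) rfl rfl rfl rfl fun _ _ => rfl).up

/-- The pieces are the inverse images of P and Q. A common point would have a single value lying in
both P and Q. -/
theorem similar_split (h : Γ ⊩ similar u U) (hU : Γ ⊩ isUnion U P Q) (hD : Γ ⊩ disjoint P Q)
    (k : ∀ {Δ} [Le Γ Δ] p q, (Δ ⊩ similar p P) → (Δ ⊩ similar q Q) → (Δ ⊩ disjoint p q) →
      (Δ ⊩ isUnion u p q) → Δ ⊢ₛ χ) : Γ ⊢ₛ χ := by
  refine similar_elim h fun {Δ} _ f hf => ?_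
  have hPU : ∀ {Θ} [Le Δ Θ] t, (Θ ⊩ t ∈ₛ P) → Θ ⊢ₛ t ∈ₛ U := fun {_} _ t ht =>
    (mem_union hU).2 (.orI₁ ht)
  have hQU : ∀ {Θ} [Le Δ Θ] t, (Θ ⊩ t ∈ₛ Q) → Θ ⊢ₛ t ∈ₛ U := fun {_} _ t ht =>
    (mem_union hU).2 (.orI₂ ht)
  refine exists_preimage hf hPU fun {Δ'} _ p hip hep hp => ?_
  -- `Bij` quantifies over all extensions of its context, so it persists in the context that now
  -- contains p.
  have hf' : Bij Δ' u U fun x y => pairMem x y f :=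
    ⟨fun h k => hf.total h k, fun h k => hf.surj h k, fun h₁ h₂ h₃ h₄ h₅ => hf.func h₁ h₂ h₃ h₄ h₅,
      fun h₁ h₂ h₃ h₄ h₅ => hf.inj h₁ h₂ h₃ h₄ h₅⟩
  refine exists_preimage hf' (fun t ht => hQU t ht) fun q hiq heq hq => ?_
  refine k p q hp hq ?_ (setOf_intro (fun x _ _ hx => ?_) fun x _ _ hx => ?_)
  · refine disjoint_intro fun x hx hx' => hep hx fun y hy hx i => heq hx' fun z hz _ j => ?_
    refine cut (hf.func hx (hPU y hy) (hQU z hz) i j) fun e => ?_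
    exact not_mem_of_disjoint hD (mem_congr_left e hy) hz
  · refine hf.total hx fun y hy i => or_elim ((mem_union hU).1 hy) (fun hy => ?_) fun hy => ?_
    · exact .orI₁ (hip hy hx i)
    · exact .orI₂ (hiq hy hx i)
  · exact or_elim hx (fun hx => hep hx fun _ _ hx _ => hx) fun hx => heq hx fun _ _ hx _ => hx

theorem union_single_of_adjoin (h : Γ ⊩ isAdjoin u v a) (hA : Γ ⊩ isSingle A a) :
    Γ ⊢ₛ isUnion u v A := by
  refine setOf_intro (fun t _ _ ht => ?_) fun t _ _ ht => ?_
  · exact or_elim ((mem_adjoin h).1 ht) (fun i => .orI₁ i) fun i => .orI₂ ((mem_single hA).2 i)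
  · exact or_elim ht (fun i => (mem_adjoin h).2 (.orI₁ i)) fun i =>
      (mem_adjoin h).2 (.orI₂ ((mem_single hA).1 i))

theorem adjoin_of_union_single (h : Γ ⊩ isUnion u v A) (hA : Γ ⊩ isSingle A a) :
    Γ ⊢ₛ isAdjoin u v a := by
  refine setOf_intro (fun t _ _ ht => ?_) fun t _ _ ht => ?_
  · exact or_elim ((mem_union h).1 ht) (fun i => .orI₁ i) fun i => .orI₂ ((mem_single hA).1 i)
  · exact or_elim ht (fun i => (mem_union h).2 (.orI₁ i)) fun i =>
      (mem_union h).2 (.orI₂ ((mem_single hA).2 i))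

theorem disjoint_single (h : Γ ⊩ (a ∈ₛ v).neg) (hA : Γ ⊩ isSingle A a) : Γ ⊢ₛ disjoint v A :=
  disjoint_intro fun _ hv hA' => neg_elim h (mem_congr_left ((mem_single hA).1 hA') hv)

theorem similar_adjoin (h : Γ ⊩ similar v V) (hu : Γ ⊩ isAdjoin u v a) (hU : Γ ⊩ isAdjoin U V b)
    (ha : Γ ⊩ (a ∈ₛ v).neg) (hb : Γ ⊩ (b ∈ₛ V).neg) : Γ ⊢ₛ similar u U := by
  refine exists_single a fun A hA => exists_single b fun B hB => ?_
  exact similar_union h (similar_single hA hB) (disjoint_single ha hA) (disjoint_single hb hB)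
    (union_single_of_adjoin hu hA) (union_single_of_adjoin hU hB)

/-- The set splits along U = V ∪ {b}, and the inverse image of {b} is a singleton {a} by
injectivity. -/
theorem similar_split_adjoin (h : Γ ⊩ similar u U) (hU : Γ ⊩ isAdjoin U V b)
    (hb : Γ ⊩ (b ∈ₛ V).neg) (k : ∀ {Δ} [Le Γ Δ] v a, (Δ ⊩ similar v V) → (Δ ⊩ (a ∈ₛ v).neg) →
      (Δ ⊩ isAdjoin u v a) → Δ ⊢ₛ χ) : Γ ⊢ₛ χ := by
  refine exists_single b fun B hB => ?_
  refine similar_split h (union_single_of_adjoin hU hB) (disjoint_single hb hB)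
    fun v q hv hq hd hu => similar_elim hq fun {Δ} _ f hf => ?_
  have hbB : Δ ⊩ b ∈ₛ B := (mem_single hB).2 (.eqI b)
  refine hf.surj hbB fun a ha i => ?_
  refine cut (φ := isSingle q a) (setOf_intro (fun t _ _ ht => ?_) fun t _ _ ht =>
    mem_congr_left (eq_symm ht) ha) fun hq => ?_
  · refine hf.total ht fun y hy j => hf.inj ht ha hbB (pairMem_congr j (.eqI t) ?_) i
    exact (mem_single hB).1 hy
  · exact k v a hv (neg_intro fun i => not_mem_of_disjoint hd i ha) (adjoin_of_union_single hu hq)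

theorem similar_USC (h : Γ ⊩ similar X Y) (hs : Γ ⊩ isUSC s X) (ht : Γ ⊩ isUSC t Y) :
    Γ ⊢ₛ similar s t := by
  refine similar_elim h fun {Δ} _ f hf => ?_
  have h : Bij Δ s t fun a b => ∃ₛ ∃ₛ (1 ∈ₛ (X + 2) ⋏ 0 ∈ₛ (Y + 2) ⋏ isSingle (a + 2) 1 ⋏
      isSingle (b + 2) 0 ⋏ pairMem 1 0 (f + 2)) := by
    have elim : ∀ {Θ} [Le Δ Θ] {a b χ}, (Θ ⊩ (∃ₛ ∃ₛ (1 ∈ₛ (X + 2) ⋏ 0 ∈ₛ (Y + 2) ⋏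
        isSingle (a + 2) 1 ⋏ isSingle (b + 2) 0 ⋏ pairMem 1 0 (f + 2)))) →
        (∀ {Ξ} [Le Θ Ξ] x y, (Ξ ⊩ x ∈ₛ X) → (Ξ ⊩ y ∈ₛ Y) → (Ξ ⊩ isSingle a x) →
          (Ξ ⊩ isSingle b y) → (Ξ ⊩ pairMem x y f) → Ξ ⊢ₛ χ) → Θ ⊢ₛ χ := fun h k =>
      ex_elim h fun x h => ex_elim h fun y h => k x y h.andE₁ h.andE₂.andE₁ h.andE₂.andE₂.andE₁
        h.andE₂.andE₂.andE₂.andE₁ h.andE₂.andE₂.andE₂.andE₂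
    refine ⟨fun {_} _ a χ ha k => ?_, fun {_} _ b χ hb k => ?_, fun {_} _ a b b' _ _ _ i j => ?_,
      fun {_} _ a a' b _ _ _ i j => ?_⟩
    · refine mem_USC_elim hs ha fun x hx hax => hf.total hx fun y hy i =>
        exists_single y fun b hb => k b (mem_USC_intro ht hy hb) ?_
      exact .exI x (.exI y (.andI hx (.andI hy (.andI hax (.andI hb i)))))
    · refine mem_USC_elim ht hb fun y hy hby => hf.surj hy fun x hx i =>
        exists_single x fun a ha => k a (mem_USC_intro hs hx ha) ?_
      exact .exI x (.exI y (.andI hx (.andI hy (.andI ha (.andI hby i)))))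
    · refine elim i fun x y hx hy hax hby i => elim j fun x' y' hx' hy' hax' hby' j => ?_
      refine cut (hf.func hx' hy hy' (pairMem_congr i (single_inj hax hax') (.eqI y)) j) fun e => ?_
      exact setOf_unique (single_congr hby e) hby'
    · refine elim i fun x y hx hy hax hby i => elim j fun x' y' hx' hy' hax' hby' j => ?_
      refine cut (hf.inj hx hx' hy' (pairMem_congr i (.eqI x) (single_inj hby hby')) j) fun e => ?_
      exact setOf_unique (single_congr hax e) hax'
  exact h.similar (∃ₛ ∃ₛ (1 ∈ₛ 6 ⋏ 0 ∈ₛ 7 ⋏ isSingle 3 1 ⋏ isSingle 2 0 ⋏ pairMem 1 0 8))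
    [X, Y, f] (asgn [1, 1, 2, 2, 1, 1, 3]) ⟨0, 0, rfl, rfl, strat_single rfl rfl,
      strat_single rfl rfl, strat_pairMem rfl rfl rfl⟩ rfl rfl rfl rfl fun _ _ => rfl

end INF

namespace INF

variable {Γ : List Fml} {φ ψ χ : Fml}
  {a b c f p q s t u v w x y z κ σ A B P Q P' s' U V X Y Z X' Y' : ℕ}

/-! ### Double singletons and the iterated `USC` -/

/-- `a = {{x}}` -/
def isDSingle (a x : ℕ) : Fml := ∃ₛ (isSingle 0 (x + 1) ⋏ isSingle (a + 1) 0)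

/-- `s = USC(USC(X))` -/
def isUSC2 (s X : ℕ) : Fml := isSetOf s (∃ₛ (0 ∈ₛ (X + 2) ⋏ isDSingle 1 0))

section Strat

variable {τ : ℕ → ℕ} {k : ℕ}

theorem strat_dsingle (hx : τ x = k) (ha : τ a = k + 2) : StratBy τ (isDSingle a x) :=
  ⟨k + 1, strat_single hx rfl, strat_single (k := k + 1) rfl ha⟩

theorem strat_USC2 (hX : τ X = k + 1) (hs : τ s = k + 3) : StratBy τ (isUSC2 s X) :=
  strat_setOf hs ⟨k, hX, strat_dsingle rfl rfl⟩

theorem strat_finite (hX : τ X = k + 1) : StratBy τ (isFinite X) :=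
  ⟨k + 2, ⟨⟨k + 1, strat_empty rfl, rfl⟩, k + 1, k, ⟨rfl, rfl, trivial⟩, k + 1,
    strat_adjoin rfl rfl rfl, rfl⟩, show k + 2 = τ X + 1 by rw [hX]⟩

end Strat

theorem dsingle_elim (h : Γ ⊩ isDSingle a x)
    (k : ∀ {Δ} [Le Γ Δ] b, (Δ ⊩ isSingle b x) → (Δ ⊩ isSingle a b) → Δ ⊢ₛ χ) : Γ ⊢ₛ χ :=
  ex_elim h fun b h => k b h.andE₁ h.andE₂

theorem exists_dsingle (x : ℕ) (k : ∀ {Δ} [Le Γ Δ] (z : ℕ), (Δ ⊩ isDSingle z x) → Δ ⊢ₛ χ) :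
    Γ ⊢ₛ χ :=
  exists_single x fun b hb => exists_single b fun a ha => k a (.exI b (.andI hb ha))

theorem dsingle_inj (h : Γ ⊩ isDSingle a x) (h' : Γ ⊩ isDSingle a y) : Γ ⊢ₛ x ≐ y := by
  refine dsingle_elim h fun b hb hab => dsingle_elim h' fun c hc hac => ?_
  exact single_inj (setOf_congr hb (single_inj hab hac)) hc

theorem dsingle_unique (h : Γ ⊩ isDSingle a x) (h' : Γ ⊩ isDSingle b x) : Γ ⊢ₛ a ≐ b := by
  refine dsingle_elim h fun c hc hac => dsingle_elim h' fun d hd hbd => ?_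
  exact setOf_unique (single_congr hac (setOf_unique hc hd)) hbd

theorem dsingle_congr (h : Γ ⊩ isDSingle a x) (ha : Γ ⊩ a ≐ b) (hx : Γ ⊩ x ≐ y) :
    Γ ⊢ₛ isDSingle b y :=
  .eqE (isDSingle (b + 1) 0) hx (.eqE (isDSingle 0 (x + 1)) ha h)

theorem exists_USC2 (X : ℕ) (k : ∀ {Δ} [Le Γ Δ] (z : ℕ), (Δ ⊩ isUSC2 z X) → Δ ⊢ₛ χ) : Γ ⊢ₛ χ :=
  exists_setOf (∃ₛ (0 ∈ₛ 2 ⋏ isDSingle 1 0)) [X] (asgn [2, 1]) ⟨0, rfl, strat_dsingle rfl rfl⟩ k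

theorem mem_USC2_intro (h : Γ ⊩ isUSC2 s X) (hx : Γ ⊩ x ∈ₛ X) (ha : Γ ⊩ isDSingle a x) :
    Γ ⊢ₛ a ∈ₛ s :=
  (mem_setOf h).2 (.exI x (.andI hx ha))

theorem mem_USC2_elim (h : Γ ⊩ isUSC2 s X) (ha : Γ ⊩ a ∈ₛ s)
    (k : ∀ {Δ} [Le Γ Δ] x, (Δ ⊩ x ∈ₛ X) → (Δ ⊩ isDSingle a x) → Δ ⊢ₛ χ) : Γ ⊢ₛ χ :=
  ex_elim ((mem_setOf h).1 ha) fun x h => k x h.andE₁ h.andE₂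

theorem USC2_of_USC (hs : Γ ⊩ isUSC s X) (ht : Γ ⊩ isUSC t s) : Γ ⊢ₛ isUSC2 t X := by
  refine setOf_intro (fun a _ _ ha => ?_) fun a _ _ ha => ?_
  · refine mem_USC_elim ht ha fun b hb hab => mem_USC_elim hs hb fun x hx hbx => ?_
    exact .exI x (.andI hx (.exI b (.andI hbx hab)))
  · refine ex_elim ha fun x h => dsingle_elim h.andE₂ fun b hb hab => ?_
    exact mem_USC_intro ht (mem_USC_intro hs h.andE₁ hb) hab

theorem USC2_empty (hs : Γ ⊩ isUSC2 s X) (hX : Γ ⊩ isEmpty X) : Γ ⊢ₛ isEmpty s :=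
  empty_intro fun _ ht => mem_USC2_elim hs ht fun _ hx _ => not_mem_empty hX hx

theorem empty_of_USC2 (hs : Γ ⊩ isUSC2 s X) (h : Γ ⊩ isEmpty s) : Γ ⊢ₛ isEmpty X :=
  empty_intro fun x hx => exists_dsingle x fun _ ha => not_mem_empty h (mem_USC2_intro hs hx ha)

theorem not_mem_USC2 (hs : Γ ⊩ isUSC2 s Y) (ha : Γ ⊩ isDSingle a b) (hb : Γ ⊩ (b ∈ₛ Y).neg) :
    Γ ⊢ₛ (a ∈ₛ s).neg :=
  neg_intro fun h => mem_USC2_elim hs h fun _ hx hax =>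
    neg_elim hb (mem_congr_left (dsingle_inj hax ha) hx)

theorem USC2_adjoin (hs : Γ ⊩ isUSC2 s Y) (hs' : Γ ⊩ isUSC2 s' Y') (ha : Γ ⊩ isDSingle a b)
    (hY : Γ ⊩ isAdjoin Y' Y b) : Γ ⊢ₛ isAdjoin s' s a := by
  refine setOf_intro (fun t _ _ ht => ?_) fun t _ _ ht => ?_
  · refine mem_USC2_elim hs' ht fun y hy hty => or_elim ((mem_adjoin hY).1 hy) (fun hy => ?_)
      fun e => ?_
    · exact .orI₁ (mem_USC2_intro hs hy hty)
    · exact .orI₂ (dsingle_unique (dsingle_congr hty (.eqI t) e) ha)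
  · refine or_elim ht (fun ht => mem_USC2_elim hs ht fun y hy hty => ?_) fun e => ?_
    · exact mem_USC2_intro hs' ((mem_adjoin hY).2 (.orI₁ hy)) hty
    · exact mem_USC2_intro hs' ((mem_adjoin hY).2 (.orI₂ (.eqI b)))
        (dsingle_congr ha (eq_symm e) (.eqI b))

/-- A decomposition `USC(USC(Y)) = v ∪ {a}` comes from a decomposition of `Y`. -/
theorem USC2_split (hs : Γ ⊩ isUSC2 s Y) (h : Γ ⊩ isAdjoin s v a) (ha : Γ ⊩ (a ∈ₛ v).neg)
    (k : ∀ {Δ} [Le Γ Δ] X b, (Δ ⊩ isUSC2 v X) → (Δ ⊩ (b ∈ₛ X).neg) → (Δ ⊩ isAdjoin Y X b) →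
      Δ ⊢ₛ χ) : Γ ⊢ₛ χ := by
  refine mem_USC2_elim hs ((mem_adjoin h).2 (.orI₂ (.eqI a))) fun b hb hab => ?_
  -- X collects the x with {{x}} ∈ v; its typing puts v three levels above x. The element b comes
  -- from a = {{b}}.
  refine exists_setOf (∃ₛ (0 ∈ₛ 2 ⋏ isDSingle 0 1)) [v] (asgn [0, 3])
    ⟨2, rfl, strat_dsingle rfl rfl⟩ fun {Δ} _ X hX => ?_
  have hi : ∀ {Θ} [Le Δ Θ] {t x}, (Θ ⊩ t ∈ₛ v) → (Θ ⊩ isDSingle t x) → Θ ⊢ₛ x ∈ₛ X :=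
    fun {_} _ t x ht htx => (mem_setOf hX).2 (.exI t (.andI ht htx))
  have he : ∀ {Θ} [Le Δ Θ] {t x}, (Θ ⊩ x ∈ₛ X) → (Θ ⊩ isDSingle t x) → Θ ⊢ₛ t ∈ₛ v := by
    intro Θ _ t x hx htx
    refine ex_elim ((mem_setOf hX).1 hx) fun r hr => ?_
    exact mem_congr_left (dsingle_unique hr.andE₂ htx) hr.andE₁
  refine k X b (setOf_intro (fun t _ _ ht => ?_) fun t _ _ ht => ?_)
    (neg_intro fun hbX => neg_elim ha (he hbX hab)) (setOf_intro (fun y _ _ hy => ?_)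
      fun y _ _ hy => ?_)
  · refine mem_USC2_elim hs ((mem_adjoin h).2 (.orI₁ ht)) fun x _ htx => ?_
    exact .exI x (.andI (hi ht htx) htx)
  · exact ex_elim ht fun x hx => he hx.andE₁ hx.andE₂
  · refine exists_dsingle y fun t ht => ?_
    refine or_elim ((mem_adjoin h).1 (mem_USC2_intro hs hy ht)) (fun htv => ?_) fun e => ?_
    · exact .orI₁ (hi htv ht)
    · exact .orI₂ (dsingle_inj (dsingle_congr ht e (.eqI y)) hab)
  · refine or_elim hy (fun hy => exists_dsingle y fun t ht => ?_) fun e => ?_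
    · refine mem_USC2_elim hs ((mem_adjoin h).2 (.orI₁ (he hy ht))) fun x hx htx => ?_
      exact mem_congr_left (dsingle_inj htx ht) hx
    · exact mem_congr_left (eq_symm e) hb

/-- 𝕋(Nc(X)) = Nc(USC(X)), because USC respects similarity. Two applications reduce 𝕋² of the given
cardinals to `Nc` of an iterated USC. -/
theorem Nc_T (hκ : Γ ⊩ isNc κ X) (hσ : Γ ⊩ isT σ κ) (hs : Γ ⊩ isUSC s X) : Γ ⊢ₛ isNc σ s := by
  refine setOf_intro (fun u _ _ hu => ?_) fun u _ _ hu => ?_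
  · exact mem_T_elim hσ hu fun x t hx ht hut =>
      similar_trans hut (similar_USC ((mem_Nc hκ).1 hx) ht hs)
  · exact mem_T_intro hσ ((mem_Nc hκ).2 (similar_refl X)) hs hu

/-! ### Products -/

theorem prod_empty_left (hP : Γ ⊩ isProd P X Y) (hX : Γ ⊩ isEmpty X) : Γ ⊢ₛ isEmpty P :=
  empty_intro fun _ ht => mem_prod_elim hP ht fun _ _ hx _ _ => not_mem_empty hX hx

theorem prod_empty_right (hP : Γ ⊩ isProd P X Y) (hY : Γ ⊩ isEmpty Y) : Γ ⊢ₛ isEmpty P :=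
  empty_intro fun _ ht => mem_prod_elim hP ht fun _ _ _ hy _ => not_mem_empty hY hy

theorem prod_adjoin_right (hY : Γ ⊩ isAdjoin Y' Y b) (hP' : Γ ⊩ isProd P' X Y')
    (hP : Γ ⊩ isProd P X Y) (hB : Γ ⊩ isSingle B b) (hQ : Γ ⊩ isProd Q X B) :
    Γ ⊢ₛ isUnion P' P Q := by
  refine setOf_intro (fun t _ _ ht => ?_) fun t _ _ ht => ?_
  · refine mem_prod_elim hP' ht fun x y hx hy h => or_elim ((mem_adjoin hY).1 hy) (fun hy => ?_)
      fun e => ?_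
    · exact .orI₁ (mem_prod_intro hP hx hy h)
    · exact .orI₂ (mem_prod_intro hQ hx ((mem_single hB).2 e) h)
  · refine or_elim ht (fun ht => mem_prod_elim hP ht fun x y hx hy h => ?_)
      fun ht => mem_prod_elim hQ ht fun x y hx hy h => ?_
    · exact mem_prod_intro hP' hx ((mem_adjoin hY).2 (.orI₁ hy)) h
    · exact mem_prod_intro hP' hx ((mem_adjoin hY).2 (.orI₂ ((mem_single hB).1 hy))) h

theorem prod_disjoint (hb : Γ ⊩ (b ∈ₛ Y).neg) (hP : Γ ⊩ isProd P X Y) (hB : Γ ⊩ isSingle B b)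
    (hQ : Γ ⊩ isProd Q X B) : Γ ⊢ₛ disjoint P Q := by
  refine disjoint_intro fun t ht ht' => mem_prod_elim hP ht fun x y _ hy h =>
    mem_prod_elim hQ ht' fun x' y' _ hy' h' => neg_elim hb (mem_congr_left ?_ hy)
  exact eq_trans (pair_inj_right h h') ((mem_single hB).1 hy')

theorem prod_adjoin_left (hX : Γ ⊩ isAdjoin X' X a) (hP' : Γ ⊩ isProd P' X' B)
    (hP : Γ ⊩ isProd P X B) (hB : Γ ⊩ isSingle B b) (ht : Γ ⊩ isPair t a b) :
    Γ ⊢ₛ isAdjoin P' P t := by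
  refine setOf_intro (fun s _ _ hs => ?_) fun s _ _ hs => ?_
  · refine mem_prod_elim hP' hs fun x y hx hy h => or_elim ((mem_adjoin hX).1 hx) (fun hx => ?_)
      fun e => ?_
    · exact .orI₁ (mem_prod_intro hP hx hy h)
    · exact .orI₂ (setOf_unique (pair_congr h e ((mem_single hB).1 hy)) ht)
  · refine or_elim hs (fun hs => mem_prod_elim hP hs fun x y hx hy h => ?_) fun e => ?_
    · exact mem_prod_intro hP' ((mem_adjoin hX).2 (.orI₁ hx)) hy h
    · exact mem_congr_left (eq_symm e) (mem_prod_intro hP' ((mem_adjoin hX).2 (.orI₂ (.eqI a)))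
        ((mem_single hB).2 (.eqI b)) ht)

/-- The bijection is {{x}} ↦ ⟨x, b⟩. Both sides lie two types above x, so its graph is given by
stratified comprehension; this is the source of 𝕋² in the theorem. -/
theorem similar_USC2_prod (hs : Γ ⊩ isUSC2 s X) (hB : Γ ⊩ isSingle B b) (hP : Γ ⊩ isProd P X B) :
    Γ ⊢ₛ similar s P := by
  have h : Bij Γ s P fun a p => ∃ₛ (isDSingle (a + 1) 0 ⋏ isPair (p + 1) 0 (b + 1)) := by
    refine ⟨fun {_} _ a χ ha k => ?_, fun {_} _ p χ hp k => ?_, fun {_} _ a p p' _ _ _ i j => ?_,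
      fun {_} _ a a' p _ _ _ i j => ?_⟩
    · refine mem_USC2_elim hs ha fun x hx hax => exists_pair x b fun p hp => ?_
      exact k p (mem_prod_intro hP hx ((mem_single hB).2 (.eqI b)) hp) (.exI x (.andI hax hp))
    · refine mem_prod_elim hP hp fun x y hx hy h => exists_dsingle x fun a ha => ?_
      exact k a (mem_USC2_intro hs hx ha)
        (.exI x (.andI ha (pair_congr h (.eqI x) ((mem_single hB).1 hy))))
    · refine ex_elim i fun x i => ex_elim j fun y j => ?_
      exact setOf_unique (pair_congr i.andE₂ (dsingle_inj i.andE₁ j.andE₁) (.eqI b)) j.andE₂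
    · refine ex_elim i fun x i => ex_elim j fun y j => ?_
      exact dsingle_unique (dsingle_congr i.andE₁ (.eqI a) (pair_inj_left i.andE₂ j.andE₂)) j.andE₁
  exact h.similar (∃ₛ (isDSingle 2 0 ⋏ isPair 1 0 5)) [b] (asgn [2, 2, 3, 3, 0])
    ⟨0, strat_dsingle rfl rfl, strat_pair rfl rfl rfl⟩ rfl rfl rfl rfl fun _ _ => rfl

/-! ### Finite sets -/

theorem finite_induction (h : Γ ⊩ isFinite X) (h₀ : ∀ {Δ} [Le Γ Δ] e, (Δ ⊩ isEmpty e) → Δ ⊢ₛ e ∈ₛ w)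
    (h₁ : ∀ {Δ} [Le Γ Δ] u z t, (Δ ⊩ u ∈ₛ w) → (Δ ⊩ (z ∈ₛ u).neg) → (Δ ⊩ isAdjoin t u z) →
      Δ ⊢ₛ t ∈ₛ w) : Γ ⊢ₛ X ∈ₛ w := by
  refine .impE (.allE w h) (.andI ?_ ?_)
  · exact exists_empty fun e he => .exI e (.andI he (h₀ e he))
  · refine all_intro fun u => all_intro fun z => imp_intro fun i => ?_
    exact exists_adjoin u z fun t ht => .exI t (.andI ht (h₁ u z t i.andE₁ i.andE₂ ht))

/-- The defining closure conditions on `w` provide only some empty set and some adjunction in `w`;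
extensionality passes to every such set. -/
theorem finite_intro (h : ∀ {Δ} [Le Γ Δ] w, (∀ {Θ} [Le Δ Θ] e, (Θ ⊩ isEmpty e) → Θ ⊢ₛ e ∈ₛ w) →
    (∀ {Θ} [Le Δ Θ] u z t, (Θ ⊩ u ∈ₛ w) → (Θ ⊩ (z ∈ₛ u).neg) → (Θ ⊩ isAdjoin t u z) →
      Θ ⊢ₛ t ∈ₛ w) → Δ ⊢ₛ X ∈ₛ w) : Γ ⊢ₛ isFinite X := by
  refine all_intro fun w => imp_intro fun i => h w (fun e he => ?_) fun u z t hu hz ht => ?_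
  · exact ex_elim i.andE₁ fun e' h => mem_congr_left (setOf_unique h.andE₁ he) h.andE₂
  · exact ex_elim (.impE (.allE z (.allE u i.andE₂)) (.andI hu hz)) fun t' h =>
      mem_congr_left (setOf_unique h.andE₁ ht) h.andE₂

theorem finite_empty (hX : Γ ⊩ isEmpty X) : Γ ⊢ₛ isFinite X := finite_intro fun _ h₀ _ => h₀ X hX

theorem finite_adjoin (hu : Γ ⊩ isFinite u) (hz : Γ ⊩ (z ∈ₛ u).neg) (ht : Γ ⊩ isAdjoin t u z) :
    Γ ⊢ₛ isFinite t := by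
  refine finite_intro fun w h₀ h₁ => h₁ u z t ?_ hz ht
  exact finite_induction hu (fun e he => h₀ e he) fun u z t i j k => h₁ u z t i j k

/-- Induction on V, with disjointness from U kept inside the induction formula. A new element z of V
∪ {z} lies neither in V nor, by disjointness, in U, so it can be adjoined to U ∪ V. -/
theorem finite_union (hU : Γ ⊩ isFinite U) (hV : Γ ⊩ isFinite V) (hd : Γ ⊩ disjoint U V)
    (hZ : Γ ⊩ isUnion Z U V) : Γ ⊢ₛ isFinite Z := by
  refine exists_setOf (disjoint 1 0 ⇒ₛ ∀ₛ (isUnion 0 2 1 ⇒ₛ isFinite 0)) [U] (asgn [1, 1])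
    ⟨strat_disjoint rfl rfl, 1, strat_union rfl rfl rfl, strat_finite rfl⟩ fun {Δ} _ w hw => ?_
  have hi : ∀ {Θ} [Le Δ Θ] V, (∀ {Ξ} [Le Θ Ξ] Z, (Ξ ⊩ disjoint U V) → (Ξ ⊩ isUnion Z U V) →
      Ξ ⊢ₛ isFinite Z) → Θ ⊢ₛ V ∈ₛ w := fun {_} _ V h =>
    (mem_setOf hw).2 (imp_intro fun hd => all_intro fun Z => imp_intro fun hZ => h Z hd hZ)
  have he : ∀ {Θ} [Le Δ Θ] {V Z}, (Θ ⊩ V ∈ₛ w) → (Θ ⊩ disjoint U V) → (Θ ⊩ isUnion Z U V) →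
      Θ ⊢ₛ isFinite Z := fun {_} _ V Z h hd hZ =>
    .impE (.allE Z (.impE ((mem_setOf hw).1 h) hd)) hZ
  refine he (finite_induction hV (fun e hE => hi e fun Z hd hZ => ?_)
    fun V z V' hV hz hV' => hi V' fun Z' hd hZ' => ?_) hd hZ
  · refine cut (φ := U ≐ Z) (ext (fun t _ _ ht => (mem_union hZ).2 (.orI₁ ht)) fun t _ _ ht => ?_)
      fun e => .eqE (isFinite 0) e hU
    exact or_elim ((mem_union hZ).1 ht) (fun i => i) fun i => not_mem_empty hE i
  · refine exists_union U V fun Z hZ => ?_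
    refine finite_adjoin (u := Z) (z := z) (he hV ?_ hZ) (neg_intro fun hzZ => ?_)
      (setOf_intro (fun t _ _ ht => ?_) fun t _ _ ht => ?_)
    · exact disjoint_intro fun t h₁ h₂ =>
        not_mem_of_disjoint hd h₁ ((mem_adjoin hV').2 (.orI₁ h₂))
    · refine or_elim ((mem_union hZ).1 hzZ) (fun i => ?_) fun i => neg_elim hz i
      exact not_mem_of_disjoint hd i ((mem_adjoin hV').2 (.orI₂ (.eqI z)))
    · refine or_elim ((mem_union hZ').1 ht) (fun i => .orI₁ ((mem_union hZ).2 (.orI₁ i))) fun i => ?_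
      exact or_elim ((mem_adjoin hV').1 i) (fun i => .orI₁ ((mem_union hZ).2 (.orI₂ i)))
        fun i => .orI₂ i
    · refine or_elim ht (fun i => or_elim ((mem_union hZ).1 i) (fun i => ?_) fun i => ?_) fun i => ?_
      · exact (mem_union hZ').2 (.orI₁ i)
      · exact (mem_union hZ').2 (.orI₂ ((mem_adjoin hV').2 (.orI₁ i)))
      · exact (mem_union hZ').2 (.orI₂ ((mem_adjoin hV').2 (.orI₂ i)))

theorem finite_prod_single (hX : Γ ⊩ isFinite X) (hB : Γ ⊩ isSingle B b) (hP : Γ ⊩ isProd P X B) :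
    Γ ⊢ₛ isFinite P := by
  refine exists_setOf (∀ₛ (isProd 0 1 2 ⇒ₛ isFinite 0)) [B] (asgn [1, 1])
    ⟨3, strat_prod rfl rfl rfl, strat_finite rfl⟩ fun {Δ} _ w hw => ?_
  refine cut (φ := X ∈ₛ w) (finite_induction hX (fun e hE => ?_) fun X z X' hX hz hX' => ?_)
    fun h => .impE (.allE P ((mem_setOf hw).1 h)) hP
  · exact (mem_setOf hw).2 (all_intro fun P => imp_intro fun hP =>
      finite_empty (prod_empty_left hP hE))
  · refine (mem_setOf hw).2 (all_intro fun P' => imp_intro fun hP' => exists_prod X B fun P hP =>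
      exists_pair z b fun t ht => ?_)
    refine finite_adjoin (u := P) (.impE (.allE P ((mem_setOf hw).1 hX)) hP) (neg_intro fun htP => ?_)
      (prod_adjoin_left hX' hP' hP hB ht)
    exact mem_prod_elim hP htP fun x y hx _ h =>
      neg_elim hz (mem_congr_left (pair_inj_left h ht) hx)

/-- Induction on Y: adjoining z adds the disjoint piece X × {z}, finite by `finite_prod_single`. The
induction set is stratified with X and Y at one type and the product two above. -/
theorem finite_prod (hX : Γ ⊩ isFinite X) (hY : Γ ⊩ isFinite Y) (hP : Γ ⊩ isProd P X Y) :
    Γ ⊢ₛ isFinite P := by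
  refine exists_setOf (∀ₛ (isProd 0 2 1 ⇒ₛ isFinite 0)) [X] (asgn [1, 1])
    ⟨3, strat_prod rfl rfl rfl, strat_finite rfl⟩ fun {Δ} _ w hw => ?_
  refine cut (φ := Y ∈ₛ w) (finite_induction hY (fun e hE => ?_) fun Y z Y' hY hz hY' => ?_)
    fun h => .impE (.allE P ((mem_setOf hw).1 h)) hP
  · exact (mem_setOf hw).2 (all_intro fun P => imp_intro fun hP =>
      finite_empty (prod_empty_right hP hE))
  · refine (mem_setOf hw).2 (all_intro fun P' => imp_intro fun hP' => exists_prod X Y fun P hP =>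
      exists_single z fun B hB => exists_prod X B fun Q hQ => ?_)
    exact finite_union (.impE (.allE P ((mem_setOf hw).1 hY)) hP) (finite_prod_single hX hB hQ)
      (prod_disjoint hz hP hB hQ) (prod_adjoin_right hY' hP' hP hB hQ)

end INF

namespace INF

variable {Γ : List Fml} {φ ψ χ : Fml}
  {a b c a' b' c' e m o f p q s t u v w x y z x' y' z' κ κ' σ μ μ' ν ν' A B P Q P' s' U V X Y Z X' Y' : ℕ}

/-! ### Triples -/

theorem triple_elim (h : Γ ⊩ isTriple t x y z)
    (k : ∀ {Δ} [Le Γ Δ] p q, (Δ ⊩ isPair p x y) → (Δ ⊩ isDSingle q z) → (Δ ⊩ isPair t p q) →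
      Δ ⊢ₛ χ) : Γ ⊢ₛ χ :=
  ex_elim h fun p h => ex_elim h fun a h => ex_elim h fun b h => k p b h.andE₁
    (.exI a (.andI h.andE₂.andE₁ h.andE₂.andE₂.andE₁)) h.andE₂.andE₂.andE₂

theorem exists_triple (x y z : ℕ) (k : ∀ {Δ} [Le Γ Δ] t, (Δ ⊩ isTriple t x y z) → Δ ⊢ₛ χ) :
    Γ ⊢ₛ χ :=
  exists_pair x y fun p hp => exists_single z fun a ha => exists_single a fun b hb =>
    exists_pair p b fun t ht => k t (.exI p (.exI a (.exI b (.andI hp (.andI ha (.andI hb ht))))))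

theorem triple_inj (h : Γ ⊩ isTriple t x y z) (h' : Γ ⊩ isTriple t x' y' z') :
    Γ ⊢ₛ (x ≐ x' ⋏ y ≐ y' ⋏ z ≐ z') := by
  refine triple_elim h fun p q hp hq ht => triple_elim h' fun p' q' hp' hq' ht' => ?_
  refine cut (setOf_congr hp (pair_inj_left ht ht')) fun hp => ?_
  refine .andI (pair_inj_left hp hp') (.andI (pair_inj_right hp hp') ?_)
  exact dsingle_inj (dsingle_congr hq (pair_inj_right ht ht') (.eqI z)) hq'

theorem tripleMem_elim (h : Γ ⊩ tripleMem x y z w)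
    (k : ∀ {Δ} [Le Γ Δ] t, (Δ ⊩ isTriple t x y z) → (Δ ⊩ t ∈ₛ w) → Δ ⊢ₛ χ) : Γ ⊢ₛ χ :=
  ex_elim h fun t h => k t h.andE₁ h.andE₂

theorem tripleMem_congr (h : Γ ⊩ tripleMem x y z w) (hy : Γ ⊩ y ≐ y') (hz : Γ ⊩ z ≐ z') :
    Γ ⊢ₛ tripleMem x y' z' w := by
  have h : Γ ⊢ₛ tripleMem x y' z w := .eqE (s := y) (tripleMem (x + 1) 0 (z + 1) (w + 1)) hy h
  exact .eqE (s := z) (t := z') (tripleMem (x + 1) (y' + 1) 0 (w + 1)) hz h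

/-! ### Upper bound for the graph of multiplication -/

/-- If every member of `a` is similar to `USC(USC(X))`, and `USC(USC(Y)) ∈ b`, then every member of
`c` is similar to `X × Y`. -/
def mulRel (a b c : ℕ) : Fml :=
  ∀ₛ ∀ₛ ((∀ₛ ∀ₛ (1 ∈ₛ (a + 4) ⋏ isUSC2 0 3 ⇒ₛ similar 1 0)) ⋏
      (∃ₛ (isUSC2 0 1 ⋏ 0 ∈ₛ (b + 3))) ⇒ₛ
    ∀ₛ ∀ₛ (isProd 1 3 2 ⋏ 0 ∈ₛ (c + 4) ⇒ₛ similar 0 1))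

theorem strat_mulRel {τ : ℕ → ℕ} {k : ℕ} (ha : τ a = k + 4) (hb : τ b = k + 4)
    (hc : τ c = k + 4) : StratBy τ (mulRel a b c) :=
  ⟨k + 1, k + 1, ⟨⟨k + 3, k + 3, ⟨ha, strat_USC2 rfl rfl⟩, strat_similar rfl rfl⟩,
    k + 3, strat_USC2 rfl rfl, hb⟩, k + 3, k + 3, ⟨strat_prod rfl rfl rfl, hc⟩,
    strat_similar rfl rfl⟩

theorem mulRel_congr (h : Γ ⊩ mulRel a b c) (ha : Γ ⊩ a ≐ a') (hb : Γ ⊩ b ≐ b')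
    (hc : Γ ⊩ c ≐ c') : Γ ⊢ₛ mulRel a' b' c' := by
  have h : Γ ⊢ₛ mulRel a' b c := .eqE (s := a) (mulRel 0 (b + 1) (c + 1)) ha h
  have h : Γ ⊢ₛ mulRel a' b' c := .eqE (s := b) (mulRel (a' + 1) 0 (c + 1)) hb h
  exact .eqE (s := c) (t := c') (mulRel (a' + 1) (b' + 1) 0) hc h

theorem mulRel_intro (h : ∀ {Δ} [Le Γ Δ] X Y s P u,
    (∀ {Θ} [Le Δ Θ] q t, (Θ ⊩ q ∈ₛ a) → (Θ ⊩ isUSC2 t X) → Θ ⊢ₛ similar q t) →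
    (Δ ⊩ isUSC2 s Y) → (Δ ⊩ s ∈ₛ b) → (Δ ⊩ isProd P X Y) → (Δ ⊩ u ∈ₛ c) → Δ ⊢ₛ similar u P) :
    Γ ⊢ₛ mulRel a b c := by
  refine all_intro fun X => all_intro fun Y => imp_intro fun i => all_intro fun P =>
    all_intro fun u => imp_intro fun j => ex_elim i.andE₂ fun s hs => ?_
  refine h X Y s P u (fun q t hq ht => ?_) hs.andE₁ hs.andE₂ j.andE₁ j.andE₂
  exact .impE (.allE t (.allE q i.andE₁)) (.andI hq ht)

theorem mulRel_elim (h : Γ ⊩ mulRel a b c)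
    (ha : ∀ {Δ} [Le Γ Δ] q t, (Δ ⊩ q ∈ₛ a) → (Δ ⊩ isUSC2 t X) → Δ ⊢ₛ similar q t)
    (hs : Γ ⊩ isUSC2 s Y) (hsb : Γ ⊩ s ∈ₛ b) (hP : Γ ⊩ isProd P X Y) (hu : Γ ⊩ u ∈ₛ c) :
    Γ ⊢ₛ similar u P := by
  refine .impE (.allE u (.allE P (.impE (.allE Y (.allE X h)) (.andI ?_ ?_)))) (.andI hP hu)
  · exact all_intro fun q => all_intro fun t => imp_intro fun i => ha q t i.andE₁ i.andE₂
  · exact .exI s (.andI hs hsb)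

theorem mulRel_zero_right (ho : Γ ⊩ isZero o) : Γ ⊢ₛ mulRel x o o := by
  refine mulRel_intro fun X Y s P u _ hs hso hP hu => ?_
  refine similar_of_empty ((mem_zero ho).1 hu) (prod_empty_right hP ?_)
  exact empty_of_USC2 hs ((mem_zero ho).1 hso)

theorem mulRel_zero_left (ho : Γ ⊩ isZero o) : Γ ⊢ₛ mulRel o x o := by
  refine mulRel_intro fun X Y s P u h _ _ hP hu => ?_
  refine similar_of_empty ((mem_zero ho).1 hu) (prod_empty_left hP ?_)
  -- Here the first and third arguments are both zero, so the member u of the third is also a member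
  -- of the first. Hence USC(USC(X)) is similar to the empty set u.
  refine exists_USC2 X fun t ht => empty_of_USC2 ht ?_
  exact empty_of_similar ((mem_zero ho).1 hu) (similar_symm (h u t hu ht))

/-- From USC(USC(Y)) ∈ y⁺ comes a decomposition Y = Y₀ ∪ {b} with USC(USC(Y₀)) ∈ y. A member of z +
x splits into p ∈ z, similar to X × Y₀ by hypothesis, and q ∈ x, similar to USC(USC(X)) and so to X
× {b}. Gluing gives X × Y. -/
theorem mulRel_succ (h : Γ ⊩ mulRel x y z) (hy : Γ ⊩ isSucc y' y) (hz : Γ ⊩ isAdd z' z x) :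
    Γ ⊢ₛ mulRel x y' z' := by
  refine mulRel_intro fun X Y s P u hX hs hsy hP hu => ?_
  refine mem_succ_elim hy hsy fun v a hv ha hsv => USC2_split hs hsv ha fun Y₀ b hv₀ hb hY => ?_
  refine mem_add_elim hz hu fun p q hp hq hd hu => exists_prod X Y₀ fun P₀ hP₀ =>
    exists_single b fun B hB => exists_prod X B fun Q hQ => exists_USC2 X fun t ht => ?_
  refine similar_union (mulRel_elim h (fun q t i j => hX q t i j) hv₀ hv hP₀ hp)
    (similar_trans (hX q t hq ht) (similar_USC2_prod ht hB hQ)) hd (prod_disjoint hb hP₀ hB hQ) hu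
    (prod_adjoin_right hY hP hP₀ hB hQ)

theorem mulRel_of_mulGraph (h : Γ ⊩ mulGraph x y z) : Γ ⊢ₛ mulRel x y z := by
  -- The triples whose components satisfy `mulRel` form a set: all three components get type 4 and
  -- the triple type 8. It remains to check that this set satisfies the clauses of 𝔾.
  refine exists_setOf (∀ₛ ∀ₛ ∀ₛ (isTriple 3 2 1 0 ⇒ₛ mulRel 2 1 0)) [] (asgn [8])
    ⟨4, 4, 4, strat_triple rfl rfl rfl rfl, strat_mulRel (k := 0) rfl rfl rfl⟩ fun {Δ} _ w hw => ?_
  have he : ∀ {Θ} [Le Δ Θ] {a b c}, (Θ ⊩ tripleMem a b c w) → Θ ⊢ₛ mulRel a b c := by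
    refine fun {_} _ a b c h => tripleMem_elim h fun {Ξ} _ t ht htw => ?_
    have h : Ξ ⊢ₛ ∀ₛ ∀ₛ ∀ₛ (isTriple (t + 3) 2 1 0 ⇒ₛ mulRel 2 1 0) := (mem_setOf hw).1 htw
    have h := Derives.allE c (Derives.allE b (Derives.allE a h))
    exact .impE h ht
  have hi : ∀ {Θ} [Le Δ Θ] {a b c}, (Θ ⊩ mulRel a b c) → Θ ⊢ₛ tripleMem a b c w := by
    refine fun {_} _ a b c h => exists_triple a b c fun t ht => .exI t (.andI ht
      ((mem_setOf hw).2 (all_intro fun a' => all_intro fun b' => all_intro fun c' =>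
        imp_intro fun ht' => ?_)))
    refine cut (triple_inj ht ht') fun i => ?_
    exact mulRel_congr h i.andE₁ i.andE₂.andE₁ i.andE₂.andE₂
  refine he (.impE (.allE w h) (.andI ?_ (.andI ?_ ?_)))
  · exact all_intro fun x => imp_intro fun _ => exists_zero fun o ho =>
      .exI o (.andI ho (hi (mulRel_zero_right ho)))
  · exact all_intro fun x => imp_intro fun _ => exists_zero fun o ho =>
      .exI o (.andI ho (hi (mulRel_zero_left ho)))
  · refine all_intro fun x => all_intro fun y => all_intro fun z => imp_intro fun h =>
      exists_succ y fun y' hy => exists_add z x fun z' hz => ?_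
    exact .exI y' (.exI z' (.andI hy (.andI hz (hi (mulRel_succ (he h) hy hz)))))

/-! ### Cardinals of finite sets -/

theorem Nc_empty (hs : Γ ⊩ isEmpty s) (hκ : Γ ⊩ isNc κ s) : Γ ⊢ₛ isZero κ :=
  setOf_intro (fun _ _ _ hu => empty_of_similar hs ((mem_Nc hκ).1 hu))
    fun _ _ _ hu => (mem_Nc hκ).2 (similar_of_empty hu hs)

/-- Gluing over the new element gives one inclusion; splitting a set similar to s ∪ {a} gives the
other. -/
theorem Nc_succ (hκ : Γ ⊩ isNc κ s) (ha : Γ ⊩ (a ∈ₛ s).neg) (hs : Γ ⊩ isAdjoin s' s a)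
    (hκ' : Γ ⊩ isNc κ' s') : Γ ⊢ₛ isSucc κ' κ := by
  refine setOf_intro (fun u _ _ hu => ?_) fun u _ _ hu => ?_
  · refine similar_split_adjoin ((mem_Nc hκ').1 hu) hs ha fun v b hv hb hu => ?_
    exact .exI v (.exI b (.andI ((mem_Nc hκ).2 hv) (.andI hb hu)))
  · refine ex_elim hu fun v h => ex_elim h fun b h => (mem_Nc hκ').2 ?_
    exact similar_adjoin ((mem_Nc hκ).1 h.andE₁) h.andE₂.andE₂ hs h.andE₂.andE₁ ha

theorem Nc_add (hν : Γ ⊩ isNc ν P) (hκ : Γ ⊩ isNc κ s) (hs : Γ ⊩ similar s Q)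
    (hd : Γ ⊩ disjoint P Q) (hP : Γ ⊩ isUnion P' P Q) (hν' : Γ ⊩ isNc ν' P') :
    Γ ⊢ₛ isAdd ν' ν κ := by
  refine setOf_intro (fun u _ _ hu => ?_) fun u _ _ hu => ?_
  · refine similar_split ((mem_Nc hν').1 hu) hP hd fun p q hp hq hpq hu => ?_
    exact .exI p (.exI q (.andI ((mem_Nc hν).2 hp) (.andI
      ((mem_Nc hκ).2 (similar_trans hq (similar_symm hs))) (.andI hpq hu))))
  · refine ex_elim hu fun p h => ex_elim h fun q h => (mem_Nc hν').2 ?_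
    exact similar_union ((mem_Nc hν).1 h.andE₁) (similar_trans ((mem_Nc hκ).1 h.andE₂.andE₁) hs)
      h.andE₂.andE₂.andE₁ hd h.andE₂.andE₂.andE₂ hP

/-- For each set `w` as in the definition of SF, induction on X: the empty set gives zero, and
adjoining z to X adjoins {{z}} to USC(USC(X)), which is a successor step. -/
theorem semifinite_Nc (hX : Γ ⊩ isFinite X) (hs : Γ ⊩ isUSC2 s X) (hκ : Γ ⊩ isNc κ s) :
    Γ ⊢ₛ isSemifinite κ := by
  refine all_intro fun w => imp_intro fun i => ?_
  refine exists_setOf (∀ₛ ∀ₛ (isUSC2 1 2 ⋏ isNc 0 1 ⇒ₛ 0 ∈ₛ 3)) [w] (asgn [1, 5])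
    ⟨3, 4, ⟨strat_USC2 rfl rfl, strat_setOf rfl (strat_similar rfl rfl)⟩, rfl⟩ fun {Δ} _ W hW => ?_
  have hi : ∀ {Θ} [Le Δ Θ] X, (∀ {Ξ} [Le Θ Ξ] s κ, (Ξ ⊩ isUSC2 s X) → (Ξ ⊩ isNc κ s) →
      Ξ ⊢ₛ κ ∈ₛ w) → Θ ⊢ₛ X ∈ₛ W := fun {_} _ X h => (mem_setOf hW).2 (all_intro fun s =>
    all_intro fun κ => imp_intro fun j => h s κ j.andE₁ j.andE₂)
  have he : ∀ {Θ} [Le Δ Θ] {X s κ}, (Θ ⊩ X ∈ₛ W) → (Θ ⊩ isUSC2 s X) → (Θ ⊩ isNc κ s) →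
      Θ ⊢ₛ κ ∈ₛ w := fun {_} _ X s κ h hs hκ =>
    .impE (.allE κ (.allE s ((mem_setOf hW).1 h))) (.andI hs hκ)
  refine he (finite_induction hX (fun e hE => hi e fun s κ hs hκ => ?_)
    fun X z X' hX hz hX' => hi X' fun s' κ' hs' hκ' => ?_) hs hκ
  · exact ex_elim i.andE₁ fun o ho => mem_congr_left
      (setOf_unique ho.andE₁ (Nc_empty (USC2_empty hs hE) hκ)) ho.andE₂
  · refine exists_USC2 X fun s hs => exists_Nc s fun κ hκ => exists_dsingle z fun a ha => ?_
    refine ex_elim (.impE (.allE κ i.andE₂) (he hX hs hκ)) fun σ hσ => mem_congr_left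
      (setOf_unique hσ.andE₁ ?_) hσ.andE₂
    exact Nc_succ hκ (not_mem_USC2 hs ha hz) (USC2_adjoin hs hs' ha hX') hκ'

theorem mulGraph_Nc (hX : Γ ⊩ isFinite X) (hY : Γ ⊩ isFinite Y) (hs : Γ ⊩ isUSC2 s X)
    (ht : Γ ⊩ isUSC2 t Y) (hκ : Γ ⊩ isNc κ s) (hμ : Γ ⊩ isNc μ t) (hP : Γ ⊩ isProd P X Y)
    (hν : Γ ⊩ isNc ν P) : Γ ⊢ₛ mulGraph κ μ ν := by
  refine all_intro fun w => imp_intro fun i => ?_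
  -- With X and Y at type 1, both iterated USCs and the product are at type 3, so the three
  -- cardinals share type 4 and can form a triple. Universal quantifiers over the defined sets let
  -- the induction hypothesis apply to any set satisfying their definitions.
  refine exists_setOf (∀ₛ ∀ₛ ∀ₛ ∀ₛ (isUSC2 3 4 ⋏ isNc 2 3 ⋏ isProd 1 5 4 ⋏ isNc 0 1 ⇒ₛ
      tripleMem 6 2 0 7)) [X, κ, w] (asgn [1, 1, 4, 9])
    ⟨3, 4, 3, 4, ⟨strat_USC2 rfl rfl, strat_setOf rfl (strat_similar rfl rfl),
      strat_prod rfl rfl rfl, strat_setOf rfl (strat_similar rfl rfl)⟩,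
      strat_tripleMem rfl rfl rfl rfl⟩ fun {Δ} _ W hW => ?_
  have hW : ∀ {Θ} [Le Δ Θ] {Y}, (Θ ⊢ₛ Y ∈ₛ W) ↔ (Θ ⊢ₛ ∀ₛ ∀ₛ ∀ₛ ∀ₛ (isUSC2 3 (Y + 4) ⋏ isNc 2 3 ⋏
      isProd 1 (X + 4) (Y + 4) ⋏ isNc 0 1 ⇒ₛ tripleMem (κ + 4) 2 0 (w + 4))) := mem_setOf hW
  have hi : ∀ {Θ} [Le Δ Θ] Y, (∀ {Ξ} [Le Θ Ξ] t μ P ν, (Ξ ⊩ isUSC2 t Y) → (Ξ ⊩ isNc μ t) →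
      (Ξ ⊩ isProd P X Y) → (Ξ ⊩ isNc ν P) → Ξ ⊢ₛ tripleMem κ μ ν w) → Θ ⊢ₛ Y ∈ₛ W :=
    fun {_} _ Y h => hW.2 (all_intro fun t => all_intro fun μ => all_intro fun P =>
      all_intro fun ν => imp_intro fun j =>
        h t μ P ν j.andE₁ j.andE₂.andE₁ j.andE₂.andE₂.andE₁ j.andE₂.andE₂.andE₂)
  have he : ∀ {Θ} [Le Δ Θ] {Y t μ P ν}, (Θ ⊩ Y ∈ₛ W) → (Θ ⊩ isUSC2 t Y) → (Θ ⊩ isNc μ t) →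
      (Θ ⊩ isProd P X Y) → (Θ ⊩ isNc ν P) → Θ ⊢ₛ tripleMem κ μ ν w := by
    intro Θ _ Y t μ P ν h ht hμ hP hν
    have h := Derives.allE ν (Derives.allE P (Derives.allE μ (Derives.allE t ((hW (Θ := Θ)).1 h))))
    exact .impE h (.andI ht (.andI hμ (.andI hP hν)))
  refine he (finite_induction hY (fun e hE => hi e fun t μ P ν ht hμ hP hν => ?_)
    fun Y b Y' hY hb hY' => hi Y' fun t' μ' P' ν' ht' hμ' hP' hν' => ?_) ht hμ hP hν
  · refine ex_elim (.impE (.allE κ i.andE₁) (semifinite_Nc hX hs hκ)) fun o ho => ?_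
    exact tripleMem_congr ho.andE₂ (setOf_unique ho.andE₁ (Nc_empty (USC2_empty ht hE) hμ))
      (setOf_unique ho.andE₁ (Nc_empty (prod_empty_right hP hE) hν))
  · refine exists_USC2 Y fun t ht => exists_Nc t fun μ hμ => exists_prod X Y fun P hP =>
      exists_Nc P fun ν hν => exists_dsingle b fun a ha => exists_single b fun B hB =>
      exists_prod X B fun Q hQ => ?_
    -- The third clause of 𝔾 puts ⟨κ, μ⁺, ν + κ⟩ into `w`; extensionality identifies μ⁺ and ν + κ
    -- with the cardinals of USC(USC(Y ∪ {b})) and X × (Y ∪ {b}).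
    refine ex_elim (.impE (.allE ν (.allE μ (.allE κ i.andE₂.andE₂))) (he hY ht hμ hP hν))
      fun μ₁ h => ex_elim h fun ν₁ h => ?_
    refine tripleMem_congr h.andE₂.andE₂ (setOf_unique h.andE₁ ?_)
      (setOf_unique h.andE₂.andE₁ ?_)
    · exact Nc_succ hμ (not_mem_USC2 ht ha hb) (USC2_adjoin ht ht' ha hY') hμ'
    · exact Nc_add hν hκ (similar_USC2_prod hs hB hQ) (prod_disjoint hb hP hB hQ)
        (prod_adjoin_right hY' hP' hP hB hQ) hν'

/-- Nc(X × Y) is itself one of the z with ⟨κ, μ, z⟩ ∈ 𝔾, so its members lie in the product κ · μ.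
Conversely, `mulRel` makes every member of any such z similar to X × Y. -/
theorem mul_Nc (hX : Γ ⊩ isFinite X) (hY : Γ ⊩ isFinite Y) (hs : Γ ⊩ isUSC2 s X)
    (ht : Γ ⊩ isUSC2 t Y) (hκ : Γ ⊩ isNc κ s) (hμ : Γ ⊩ isNc μ t) (hP : Γ ⊩ isProd P X Y)
    (hν : Γ ⊩ isNc ν P) : Γ ⊢ₛ isMul ν κ μ := by
  refine setOf_intro (fun u _ _ hu => ?_) fun u _ _ hu => ?_
  · exact .exI ν (.andI (mulGraph_Nc hX hY hs ht hκ hμ hP hν) hu)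
  · refine ex_elim hu fun z h => (mem_Nc hν).2 ?_
    refine mulRel_elim (mulRel_of_mulGraph h.andE₁) (fun q r hq hr => ?_) ht
      ((mem_Nc hμ).2 (similar_refl t)) hP h.andE₂
    exact .eqE (similar (q + 1) 0) (setOf_unique hs hr) ((mem_Nc hκ).1 hq)

end INF

/-! ### Assembly of the lemma. -/

theorem mainTheorem11 :
    INF.Provable
      (∀ₛ ∀ₛ ∀ₛ
        (hasDecEq 2 ⋏ isSubset 1 2 ⋏ isSubset 0 2 ⋏ isFinite 1 ⋏ isFinite 0 ⇒ₛ
          ∃ₛ (isProd 0 2 1 ⋏ isFinite 0 ⋏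
            ∃ₛ ∃ₛ ∃ₛ ∃ₛ ∃ₛ
              (isNc 4 7 ⋏ isNc 3 6 ⋏ isT2 2 4 ⋏ isT2 1 3 ⋏ isMul 0 2 1 ⋏ isNc 0 5)))) := by
  refine all_intro fun A => all_intro fun X => all_intro fun Y => imp_intro fun {Δ} _ h => ?_
  have hX : Δ ⊩ isFinite X := h.andE₂.andE₂.andE₂.andE₁
  have hY : Δ ⊩ isFinite Y := h.andE₂.andE₂.andE₂.andE₂
  refine exists_prod X Y fun P hP => .exI P (.andI hP (.andI (finite_prod hX hY hP) ?_))
  refine exists_Nc X fun κ hκ => exists_T κ fun κ₁ hκ₁ => exists_T κ₁ fun κ₂ hκ₂ =>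
    exists_Nc Y fun μ hμ => exists_T μ fun μ₁ hμ₁ => exists_T μ₁ fun μ₂ hμ₂ =>
    exists_Nc P fun ν hν => exists_USC X fun s hs => exists_USC s fun s₂ hs₂ =>
    exists_USC Y fun t ht => exists_USC t fun {Θ} _ t₂ ht₂ => ?_
  have hmul : Θ ⊢ₛ isMul ν κ₂ μ₂ := mul_Nc hX hY (USC2_of_USC hs hs₂) (USC2_of_USC ht ht₂)
    (Nc_T (Nc_T hκ hκ₁ hs) hκ₂ hs₂) (Nc_T (Nc_T hμ hμ₁ ht) hμ₂ ht₂) hP hν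
  have hT : Θ ⊢ₛ isT2 κ₂ κ := .exI κ₁ (.andI hκ₁ hκ₂)
  have hT' : Θ ⊢ₛ isT2 μ₂ μ := .exI μ₁ (.andI hμ₁ hμ₂)
  -- The five existential quantifiers are introduced from the innermost outwards; each intermediate
  -- formula records which occurrences become bound.
  have hand : Θ ⊢ₛ isNc κ X ⋏ isNc μ Y ⋏ isT2 κ₂ κ ⋏ isT2 μ₂ μ ⋏ isMul ν κ₂ μ₂ ⋏ isNc ν P :=
    .andI hκ (.andI hμ (.andI hT (.andI hT' (.andI hmul hν))))
  have hν' : Θ ⊢ₛ ∃ₛ (isNc (κ + 1) (X + 1) ⋏ isNc (μ + 1) (Y + 1) ⋏ isT2 (κ₂ + 1) (κ + 1) ⋏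
      isT2 (μ₂ + 1) (μ + 1) ⋏ isMul 0 (κ₂ + 1) (μ₂ + 1) ⋏ isNc 0 (P + 1)) := .exI ν hand
  have hμ₂' : Θ ⊢ₛ ∃ₛ ∃ₛ (isNc (κ + 2) (X + 2) ⋏ isNc (μ + 2) (Y + 2) ⋏ isT2 (κ₂ + 2) (κ + 2) ⋏
      isT2 1 (μ + 2) ⋏ isMul 0 (κ₂ + 2) 1 ⋏ isNc 0 (P + 2)) := .exI μ₂ hν'
  have hκ₂' : Θ ⊢ₛ ∃ₛ ∃ₛ ∃ₛ (isNc (κ + 3) (X + 3) ⋏ isNc (μ + 3) (Y + 3) ⋏ isT2 2 (κ + 3) ⋏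
      isT2 1 (μ + 3) ⋏ isMul 0 2 1 ⋏ isNc 0 (P + 3)) := .exI κ₂ hμ₂'
  have hμ' : Θ ⊢ₛ ∃ₛ ∃ₛ ∃ₛ ∃ₛ (isNc (κ + 4) (X + 4) ⋏ isNc 3 (Y + 4) ⋏ isT2 2 (κ + 4) ⋏
      isT2 1 3 ⋏ isMul 0 2 1 ⋏ isNc 0 (P + 4)) := .exI μ hκ₂'
  have hκ' : Θ ⊢ₛ ∃ₛ ∃ₛ ∃ₛ ∃ₛ ∃ₛ (isNc 4 (X + 5) ⋏ isNc 3 (Y + 5) ⋏ isT2 2 4 ⋏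
      isT2 1 3 ⋏ isMul 0 2 1 ⋏ isNc 0 (P + 5)) := .exI κ hμ'
  exact hκ'
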